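/- Graphs are finite, undirected and loopless, and may have multiple edges. Let $t\ge 1$ be an integer. A graph is *strictly $t$-degenerate* if every non-empty subgraph $H$ of it has a vertex $v$ with $d_H(v)\le t-1$. The *point partition number* $\chi_t(G)$ is the least integer $k\ge 0$ for which the vertices of $G$ can be colored with $k$ colors so that each color class induces a strictly $t$-degenerate subgraph of $G$. Let $\Delta(G)$ be the maximum degree of $G$, and let $sG$ be the graph obtained from $G$ by replacing each edge by $s$ parallel edges with the same two ends. $K_n$ and $C_n$ denote the complete graph and the cycle of order $n$. A connected graph is understood to be non-empty, and in (a) and (b) below equality of graphs means isomorphism. Theorem. Let $G$ be a connected graph. Then $\chi_t(G)\le \lceil \Delta(G)/t\rceil+1$, and equality holds if and only if at least one of the following holds: (a) $G=sK_{(t/s)p+1}$ for some integers $s,p$ with $1\le s\le t$, $p\ge 0$ and $s\mid t$, and $\chi_t(G)=p+1$; (b) $G=tC_n$ for some odd $n\ge 3$, and $\chi_t(G)=3$; (c) $G$ is a connected $t$-regular graph, and $\chi_t(G)=2$. Moreover, the stated values of $\chi_t$ are automatic: $\chi_t(G)=p+1$ whenever $G=sK_{(t/s)p+1}$ for integers $s,p$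 as in (a), $\chi_t(G)=3$ whenever $G=tC_n$ with $n\ge 3$ odd, and $\chi_t(G)=2$ whenever $G$ is connected and $t$-regular. -/

import Mathlib

open scoped Graph

namespace Graph

/-- The degree of `v` in a loopless multigraph: the number of edges incident with `v`. -/
noncomputable def degree {α β : Type*} (G : Graph α β) (v : α) : ℕ :=
  (G.incidenceSet v).ncard

/-- The maximum degree of a finite multigraph (`0` for the empty graph). -/
noncomputable def maxDegree {α β : Type*} (G : Graph α β) : ℕ :=
  sSup (G.degree '' V(G))

/-- Every vertex has degree `d`. -/
def IsRegularOfDegree {α β : Type*} (G : Graph α β) (d : ℕ) : Prop :=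
  ∀ v ∈ V(G), G.degree v = d

/-- A graph is connected if it is non-empty and any two vertices are joined by a walk. -/
def Connected {α β : Type*} (G : Graph α β) : Prop :=
  V(G).Nonempty ∧ ∀ x ∈ V(G), ∀ y ∈ V(G), Relation.ReflTransGen G.Adj x y

/-- Every non-empty subgraph has a vertex whose degree in that subgraph is at most `t - 1`. -/
def IsStrictlyDegenerate {α β : Type*} (G : Graph α β) (t : ℕ) : Prop :=
  ∀ H : Graph α β, H ≤ G → V(H).Nonempty → ∃ v ∈ V(H), H.degree v < t

/-- A coloring of the vertices of `G` with color set `Γ` such that each color class induces a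
strictly `t`-degenerate subgraph. -/
def IsSDColoring {α β Γ : Type*} (G : Graph α β) (t : ℕ) (φ : V(G) → Γ) : Prop :=
  ∀ c : Γ, (G.induce (Subtype.val '' (φ ⁻¹' {c}))).IsStrictlyDegenerate t

/-- The point partition number: the least `k` such that `G` has a coloring with `k` colors whose
color classes all induce strictly `t`-degenerate subgraphs. (For a finite loopless `G` and `t ≥ 1`
such `k` exist, for instance the number of vertices.) -/
noncomputable def pointPartitionNumber {α β : Type*} (G : Graph α β) (t : ℕ) : ℕ :=
  sInf {k : ℕ | ∃ φ : V(G) → Fin k, G.IsSDColoring t φ}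

/-- The `s`-uniform inflation: each edge is replaced by `s` parallel edges with the same ends. -/
def inflation {α β : Type*} (s : ℕ) (G : Graph α β) : Graph α (β × Fin s) where
  vertexSet := V(G)
  IsLink e x y := G.IsLink e.1 x y
  isLink_symm := by
    rintro e -
    exact ⟨fun x y h => Graph.IsLink.symm h⟩
  eq_or_eq_of_isLink_of_isLink _ _ _ _ _ h h' := h.left_eq_or_eq h'
  left_mem_of_isLink _ _ _ h := h.left_mem

/-- The complete graph of order `n`. -/
def complete (n : ℕ) : Graph (Fin n) (Sym2 (Fin n)) :=
  Graph.ofSimpleGraph (⊤ : SimpleGraph (Fin n))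

/-- The cycle of order `n`, for `n ≥ 3`. -/
def cycle (n : ℕ) : Graph (Fin n) (Sym2 (Fin n)) :=
  Graph.ofSimpleGraph (SimpleGraph.cycleGraph n)

/-- Isomorphism of multigraphs: bijections between the vertices and between the edges that
preserve and reflect incidence. -/
def IsIsomorphic {α β α' β' : Type*} (G : Graph α β) (H : Graph α' β') : Prop :=
  ∃ (f : V(G) ≃ V(H)) (g : E(G) ≃ E(H)), ∀ (e : E(G)) (x y : V(G)),
    G.IsLink (e : β) (x : α) (y : α) ↔ H.IsLink (g e : β') (f x : α') (f y : α')

end Graph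

/-!
Put `k = ⌈Δ(G) / t⌉`. Coloring greedily gives `χ_t(G) ≤ k + 1`, and a connected graph with
`χ_t(G) = k + 1` is regular of degree `k * t`. For `k ≥ 2` merge `k - 1` of the `k` colors, so that
there are two color classes with the thresholds `t` and `(k - 1) * t`. Any single vertex can be left
uncolored as a *hole*; its component in either color (with the hole added) is then regular of degree
the threshold of that color, and the hole can be moved to any vertex of such a component.

Move the hole alternately in the two colors, each time to a non-separating vertex, until its
component meets the remnant of an earlier one. If this remnant and the last one are adjacent, then
comparing degrees after suitable moves shows that any two vertices are joined by the same number of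
edges, so `G = sKₙ`. Otherwise the first component consists of two vertices only. If this happens
for every choice of the hole, then each vertex has at most two neighbors, so `k = 2` and `G = tCₙ`.
-/

/-- A loopless multigraph on the vertex set `V`, recorded by its edge multiplicities; the identity
of the individual edges is irrelevant for colorings. -/
structure EdgeMult (V : Type*) where
  mult : V → V → ℕ
  symm : ∀ x y, mult x y = mult y x
  loopless : ∀ x, mult x x = 0

noncomputable section

open scoped Classical

namespace EdgeMult

section Basic

variable {V Γ : Type*} {M : EdgeMult V} {t s : ℕ} {T : Γ → ℕ} {A B : Finset V} {c : V → Γ}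
  {u v x y : V}

/-- The number of edges from `v` to `A`. -/
def degreeIn (M : EdgeMult V) (A : Finset V) (v : V) : ℕ := ∑ x ∈ A, M.mult v x

/-- The multigraph induced by `A` is strictly `t`-degenerate. -/
def IsDegenerateOn (M : EdgeMult V) (t : ℕ) (A : Finset V) : Prop :=
  ∀ B ⊆ A, B.Nonempty → ∃ v ∈ B, M.degreeIn B v < t

/-- The multigraph induced by `A` is non-empty and connected, in terms of cuts. -/
def IsConnectedOn (M : EdgeMult V) (A : Finset V) : Prop :=
  A.Nonempty ∧ ∀ B ⊆ A, B.Nonempty → B ≠ A → ∃ x ∈ B, ∃ y ∈ A, y ∉ B ∧ M.mult x y ≠ 0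

/-- Any two distinct vertices of `A` are joined by exactly `s` edges: `A` induces `sKₙ`. -/
def IsUniformOn (M : EdgeMult V) (s : ℕ) (A : Finset V) : Prop :=
  ∀ x ∈ A, ∀ y ∈ A, x ≠ y → M.mult x y = s

/-- Every color class of `c` within `A` induces a strictly degenerate multigraph, where the color
`a` has the threshold `T a`. -/
def IsColoringOn (M : EdgeMult V) (T : Γ → ℕ) (A : Finset V) (c : V → Γ) : Prop :=
  ∀ a, M.IsDegenerateOn (T a) {x ∈ A | c x = a}

lemma ne_of_mult_ne_zero (h : M.mult x y ≠ 0) : x ≠ y := by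
  rintro rfl
  exact h (M.loopless x)

lemma degreeIn_mono (h : A ⊆ B) (v : V) : M.degreeIn A v ≤ M.degreeIn B v :=
  Finset.sum_le_sum_of_subset h

lemma degreeIn_insert_self (A : Finset V) (v : V) :
    M.degreeIn (insert v A) v = M.degreeIn A v :=
  Finset.sum_insert_of_eq_zero_if_notMem fun _ => M.loopless v

lemma degreeIn_erase_self (A : Finset V) (v : V) :
    M.degreeIn (A.erase v) v = M.degreeIn A v :=
  Finset.sum_erase A (M.loopless v)

lemma degreeIn_erase_add (h : x ∈ A) (v : V) :
    M.degreeIn (A.erase x) v + M.mult v x = M.degreeIn A v :=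
  Finset.sum_erase_add A _ h

lemma degreeIn_insert (h : x ∉ A) (v : V) :
    M.degreeIn (insert x A) v = M.mult v x + M.degreeIn A v :=
  Finset.sum_insert h

lemma degreeIn_congr (h : ∀ x, M.mult v x ≠ 0 → (x ∈ A ↔ x ∈ B)) :
    M.degreeIn A v = M.degreeIn B v := by
  have hfilter : {x ∈ A | M.mult v x ≠ 0} = {x ∈ B | M.mult v x ≠ 0} := by
    ext x
    simpa only [Finset.mem_filter, and_congr_left_iff] using h x
  simp only [degreeIn, ← Finset.sum_filter_ne_zero A, ← Finset.sum_filter_ne_zero B, hfilter]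

lemma exists_adj_of_degreeIn_pos (h : 0 < M.degreeIn A v) : ∃ x ∈ A, M.mult v x ≠ 0 :=
  Finset.exists_ne_zero_of_sum_ne_zero h.ne'

lemma mem_of_degreeIn_le (hAB : A ⊆ B) (h : M.degreeIn B v ≤ M.degreeIn A v) (hx : x ∈ B)
    (hvx : M.mult v x ≠ 0) : x ∈ A := by
  by_contra hxA
  have hle := degreeIn_mono (M := M) (Finset.insert_subset hx hAB) v
  rw [degreeIn_insert hxA] at hle
  lia

lemma sum_degreeIn_fiber [Fintype Γ] (A : Finset V) (c : V → Γ) (v : V) :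
    ∑ a, M.degreeIn {x ∈ A | c x = a} v = M.degreeIn A v :=
  Finset.sum_fiberwise A c _

lemma IsUniformOn.mono (h : M.IsUniformOn s B) (hAB : A ⊆ B) : M.IsUniformOn s A :=
  fun x hx y hy => h x (hAB hx) y (hAB hy)

lemma IsUniformOn.union (hA : M.IsUniformOn s A) (hB : M.IsUniformOn s B)
    (h : ∀ x ∈ A, ∀ y ∈ B, x ≠ y → M.mult x y = s) : M.IsUniformOn s (A ∪ B) := by
  intro x hx y hy hxy
  rcases Finset.mem_union.1 hx with hx | hx <;> rcases Finset.mem_union.1 hy with hy | hy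
  · exact hA x hx y hy hxy
  · exact h x hx y hy hxy
  · rw [M.symm]
    exact h y hy x hx hxy.symm
  · exact hB x hx y hy hxy

lemma IsUniformOn.degreeIn_eq (h : M.IsUniformOn s A) (hx : x ∈ A) :
    M.degreeIn A x = s * (A.card - 1) := by
  have hs : ∀ y ∈ A.erase x, M.mult x y = s := fun y hy =>
    h x hx y (Finset.mem_of_mem_erase hy) (Finset.ne_of_mem_erase hy).symm
  rw [← degreeIn_erase_self, degreeIn, Finset.sum_congr rfl hs, Finset.sum_const, smul_eq_mul,
    Finset.card_erase_of_mem hx, mul_comm]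

lemma IsDegenerateOn.mono (h : M.IsDegenerateOn t B) (hAB : A ⊆ B) : M.IsDegenerateOn t A :=
  fun C hC hn => h C (hC.trans hAB) hn

lemma IsDegenerateOn.insert (h : M.IsDegenerateOn t A) (hv : M.degreeIn A v < t) :
    M.IsDegenerateOn t (insert v A) := by
  intro B hB hn
  by_cases hvB : v ∈ B
  · refine ⟨v, hvB, (degreeIn_mono hB v).trans_lt ?_⟩
    rwa [degreeIn_insert_self]
  · exact h B ((Finset.subset_insert_iff_of_notMem hvB).1 hB) hn

lemma IsColoringOn.mono (h : M.IsColoringOn T B c) (hAB : A ⊆ B) : M.IsColoringOn T A c :=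
  fun a => (h a).mono (Finset.filter_subset_filter _ hAB)

lemma IsColoringOn.insert (h : M.IsColoringOn T A c) {b : Γ}
    (hb : M.degreeIn {x ∈ A | c x = b} v < T b) :
    M.IsColoringOn T (insert v A) (Function.update c v b) := by
  intro a
  by_cases hab : a = b
  · subst hab
    refine ((h a).insert hb).mono fun x hx => ?_
    by_cases hxv : x = v <;> simp_all
  · refine (h a).mono fun x hx => ?_
    by_cases hxv : x = v <;> simp_all

theorem exists_isColoringOn [Fintype Γ] [Nonempty Γ] (h : M.IsDegenerateOn (∑ a, T a) A) :
    ∃ c : V → Γ, M.IsColoringOn T A c := by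
  induction A using Finset.strongInduction with
  | H A ih =>
    rcases A.eq_empty_or_nonempty with rfl | hA
    · exact ⟨fun _ => Classical.arbitrary Γ, fun a B hB hn => absurd (hn.mono hB) (by simp)⟩
    obtain ⟨v, hvA, hv⟩ := h A subset_rfl hA
    obtain ⟨c, hc⟩ := ih (A.erase v) (Finset.erase_ssubset hvA) (h.mono (Finset.erase_subset v A))
    obtain ⟨b, hb⟩ : ∃ b, M.degreeIn {x ∈ A.erase v | c x = b} v < T b := by
      by_contra! hge
      have hsum := Finset.sum_le_sum fun b (_ : b ∈ Finset.univ) => hge b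
      rw [sum_degreeIn_fiber, degreeIn_erase_self] at hsum
      exact hsum.not_gt hv
    exact ⟨Function.update c v b, by simpa only [Finset.insert_erase hvA] using hc.insert hb⟩

lemma isConnectedOn_singleton (v : V) : M.IsConnectedOn {v} :=
  ⟨Finset.singleton_nonempty v, fun _ hB hn hne => absurd (hn.subset_singleton_iff.1 hB) hne⟩

lemma IsConnectedOn.subset_of_closed (hA : M.IsConnectedOn A) (hx : x ∈ A) (hxB : x ∈ B)
    (h : ∀ y ∈ A, y ∈ B → ∀ z ∈ A, M.mult y z ≠ 0 → z ∈ B) : A ⊆ B := by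
  by_contra hAB
  obtain ⟨y, hy, z, hz, hzB, hyz⟩ := hA.2 (A ∩ B) Finset.inter_subset_left
    ⟨x, Finset.mem_inter.2 ⟨hx, hxB⟩⟩ (hAB ∘ Finset.inter_eq_left.1)
  obtain ⟨hyA, hyB⟩ := Finset.mem_inter.1 hy
  exact hzB (Finset.mem_inter.2 ⟨hz, h y hyA hyB z hz hyz⟩)

lemma isConnectedOn_of_forall_subset (hA : A.Nonempty)
    (h : ∀ B ⊆ A, B.Nonempty → (∀ y ∈ B, ∀ z ∈ A, M.mult y z ≠ 0 → z ∈ B) → A ⊆ B) :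
    M.IsConnectedOn A := by
  refine ⟨hA, fun B hB hn hne => ?_⟩
  by_contra! hclosed
  exact hne (hB.antisymm (h B hB hn fun y hy z hz hyz =>
    by_contra fun hzB => hyz (hclosed y hy z hz hzB)))

lemma IsConnectedOn.insert_adj (hA : M.IsConnectedOn A) (hx : x ∈ A) (hxy : M.mult x y ≠ 0) :
    M.IsConnectedOn (insert y A) := by
  refine isConnectedOn_of_forall_subset (Finset.insert_nonempty y A) fun B hB ⟨z, hz⟩ hclosed => ?_
  have hmeet : ∃ z ∈ A, z ∈ B := by
    rcases Finset.mem_insert.1 (hB hz) with rfl | hzA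
    · exact ⟨x, hx, hclosed z hz x (Finset.mem_insert_of_mem hx) (by rwa [M.symm])⟩
    · exact ⟨z, hzA, hz⟩
  obtain ⟨z, hzA, hzB⟩ := hmeet
  have hAB : A ⊆ B := hA.subset_of_closed hzA hzB fun y _ hy z hz =>
    hclosed y hy z (Finset.mem_insert_of_mem hz)
  exact Finset.insert_subset (hclosed x (hAB hx) y (Finset.mem_insert_self y A) hxy) hAB

lemma IsConnectedOn.exists_erase (hA : M.IsConnectedOn A) (hv : v ∈ A) (hne : A ≠ {v}) :
    ∃ u ∈ A, u ≠ v ∧ M.IsConnectedOn (A.erase u) := by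
  -- A maximal proper connected subset containing `v` misses exactly one vertex.
  have hfin : {C | C ⊆ A ∧ v ∈ C ∧ C ≠ A ∧ M.IsConnectedOn C}.Finite :=
    A.powerset.finite_toSet.subset fun C hC => Finset.mem_coe.2 (Finset.mem_powerset.2 hC.1)
  obtain ⟨C, hC⟩ := hfin.exists_maximal
    ⟨{v}, by simpa using hv, by simp, hne.symm, isConnectedOn_singleton v⟩
  obtain ⟨hCA, hvC, hCne, hCconn⟩ := hC.prop
  obtain ⟨x, hx, y, hy, hyC, hxy⟩ := hA.2 C hCA ⟨v, hvC⟩ hCne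
  have heq : insert y C = A := by
    by_contra hne'
    exact hyC (hC.le_of_ge ⟨Finset.insert_subset hy hCA, Finset.mem_insert_of_mem hvC, hne',
      hCconn.insert_adj hx hxy⟩ (Finset.subset_insert y C) (Finset.mem_insert_self y C))
  refine ⟨y, hy, fun hyv => hyC (hyv ▸ hvC), ?_⟩
  rwa [← heq, Finset.erase_insert hyC]

end Basic

section Component

variable {V Γ : Type*} [Fintype V] {M : EdgeMult V} {T : Γ → ℕ} {A : Finset V} {c : V → Γ}
  {v x y : V}

/-- The vertices of color `a`. -/
def colorClass (c : V → Γ) (a : Γ) : Finset V := {x | c x = a}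

@[simp] lemma mem_colorClass {a : Γ} : x ∈ colorClass c a ↔ c x = a := by simp [colorClass]

/-- The vertex set of the component of `v` in the multigraph induced by its color class. -/
def component (M : EdgeMult V) (c : V → Γ) (v : V) : Finset V :=
  {x | Relation.ReflTransGen (fun y z => c y = c z ∧ M.mult y z ≠ 0) v x}

lemma mem_component : x ∈ M.component c v ↔
    Relation.ReflTransGen (fun y z => c y = c z ∧ M.mult y z ≠ 0) v x := by simp [component]

lemma self_mem_component (c : V → Γ) (v : V) : v ∈ M.component c v := mem_component.2 .refl

lemma mem_component_of_adj (hx : x ∈ M.component c v) (hc : c y = c x) (hxy : M.mult x y ≠ 0) :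
    y ∈ M.component c v :=
  mem_component.2 ((mem_component.1 hx).tail ⟨hc.symm, hxy⟩)

lemma component_induction {p : V → Prop} (hv : p v)
    (h : ∀ x y, p x → c y = c x → M.mult x y ≠ 0 → p y) (hx : x ∈ M.component c v) : p x := by
  induction mem_component.1 hx with
  | refl => exact hv
  | tail _ hyz ih => exact h _ _ (ih (mem_component.2 ‹_›)) hyz.1.symm hyz.2

lemma color_eq_of_mem_component (hx : x ∈ M.component c v) : c x = c v :=
  component_induction (p := fun x => c x = c v) rfl (fun _ _ hx hxy _ => hxy.trans hx) hx

lemma mem_component_symm (hx : x ∈ M.component c v) : v ∈ M.component c x :=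
  component_induction (p := fun x => v ∈ M.component c x) (self_mem_component c v)
    (fun _ _ hx hc hxy => mem_component.2 <|
      .head ⟨hc, by rwa [M.symm]⟩ (mem_component.1 hx)) hx

lemma component_eq_of_mem (hx : x ∈ M.component c v) : M.component c x = M.component c v := by
  ext y
  exact ⟨fun hy => mem_component.2 ((mem_component.1 hx).trans (mem_component.1 hy)),
    fun hy => mem_component.2
      ((mem_component.1 (mem_component_symm hx)).trans (mem_component.1 hy))⟩

lemma isConnectedOn_component (c : V → Γ) (v : V) : M.IsConnectedOn (M.component c v) := by
  refine isConnectedOn_of_forall_subset ⟨v, self_mem_component c v⟩ fun B hB ⟨z, hz⟩ hclosed => ?_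
  intro x hx
  rw [← component_eq_of_mem (hB hz)] at hx
  exact component_induction (p := (· ∈ B)) hz (fun y y' hy hc hyy' =>
    hclosed y hy y' (mem_component_of_adj (hB hy) hc hyy') hyy') hx

lemma IsConnectedOn.subset_component (hA : M.IsConnectedOn A) (hx : x ∈ A)
    (hxv : x ∈ M.component c v) (hc : ∀ y ∈ A, c y = c v) : A ⊆ M.component c v :=
  hA.subset_of_closed hx hxv fun y hy hyv z hz hyz =>
    mem_component_of_adj hyv ((hc z hz).trans (hc y hy).symm) hyz

/-- `c` is a coloring with the thresholds `T` once `v` is left uncolored; the color `c v` only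
serves to single out a component. -/
def IsHole (M : EdgeMult V) (T : Γ → ℕ) (c : V → Γ) (v : V) : Prop :=
  M.IsColoringOn T (Finset.univ.erase v) c

lemma isHole_update (b : Γ) : M.IsHole T (Function.update c v b) v ↔ M.IsHole T c v := by
  have hclass : ∀ a, {x ∈ Finset.univ.erase v | Function.update c v b x = a} =
      {x ∈ Finset.univ.erase v | c x = a} := fun a =>
    Finset.filter_congr fun x hx => by rw [Function.update_of_ne (Finset.ne_of_mem_erase hx)]
  simp only [IsHole, IsColoringOn, hclass]

lemma IsHole.isColoringOn_update (h : M.IsHole T c v) {b : Γ}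
    (hb : M.degreeIn (colorClass c b) v < T b) :
    M.IsColoringOn T Finset.univ (Function.update c v b) := by
  rw [← Finset.insert_erase (Finset.mem_univ v)]
  exact IsColoringOn.insert h (by rwa [Finset.filter_erase, degreeIn_erase_self])

lemma IsHole.move (h : M.IsHole T c v) (hne : x ≠ v)
    (hx : M.degreeIn ((colorClass c (c v)).erase x) v < T (c v)) : M.IsHole T c x := by
  have hinsert := (IsColoringOn.mono h (Finset.erase_subset x _)).insert (v := v) (b := c v) <| by
    rwa [Finset.erase_right_comm, Finset.filter_erase, degreeIn_erase_self, Finset.filter_erase]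
  rwa [Function.update_eq_self, Finset.erase_right_comm, Finset.insert_erase] at hinsert
  exact Finset.mem_erase.2 ⟨hne.symm, Finset.mem_univ v⟩

end Component

section Flip

variable {V : Type*} {v x : V} {c : V → Bool}

/-- The coloring `c` with the color of `v` exchanged. -/
def flip (c : V → Bool) (v : V) : V → Bool := Function.update c v (!c v)

@[simp] lemma flip_self (c : V → Bool) (v : V) : flip c v v = !c v :=
  Function.update_self v _ c

lemma flip_of_ne (c : V → Bool) (h : x ≠ v) : flip c v x = c x :=
  Function.update_of_ne h _ c

@[simp] lemma flip_flip (c : V → Bool) (v : V) : flip (flip c v) v = c := by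
  simp [flip]

end Flip

section Critical

variable {V : Type*} [Fintype V] {M : EdgeMult V} {T : Bool → ℕ} {c : V → Bool} {u v w x y : V}

lemma isHole_flip : M.IsHole T (flip c v) v ↔ M.IsHole T c v :=
  isHole_update _

lemma mem_component_union (hvx : M.mult v x ≠ 0) :
    x ∈ M.component c v ∪ M.component (flip c v) v := by
  by_cases hcx : c x = c v
  · exact Finset.mem_union_left _ (mem_component_of_adj (self_mem_component c v) hcx hvx)
  · refine Finset.mem_union_right _ (mem_component_of_adj (self_mem_component _ v) ?_ hvx)
    rw [flip_of_ne _ (ne_of_mult_ne_zero hvx).symm, flip_self]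
    exact Bool.eq_not_of_ne hcx

lemma color_of_mem_component_flip (hx : x ∈ M.component (flip c v) v) (hxv : x ≠ v) :
    c x = !c v := by
  rw [← flip_of_ne c hxv, color_eq_of_mem_component hx, flip_self]

/-- A connected regular multigraph whose degree is the sum of the thresholds `T` of two colors, but
which has no coloring with these thresholds. -/
structure IsCritical (M : EdgeMult V) (T : Bool → ℕ) : Prop where
  pos : ∀ b, 0 < T b
  degree_eq : ∀ v, M.degreeIn Finset.univ v = T true + T false
  connected : M.IsConnectedOn Finset.univ
  not_isColoringOn : ∀ c : V → Bool, ¬ M.IsColoringOn T Finset.univ c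

namespace IsCritical

lemma degreeIn_colorClass (hM : M.IsCritical T) (h : M.IsHole T c v) (a : Bool) :
    M.degreeIn (colorClass c a) v = T a := by
  have hge : ∀ b ∈ Finset.univ, T b ≤ M.degreeIn (colorClass c b) v := by
    intro b _
    by_contra! hlt
    exact hM.not_isColoringOn _ (h.isColoringOn_update hlt)
  have hsum : ∑ b, T b = ∑ b, M.degreeIn (colorClass c b) v := by
    rw [Fintype.sum_bool, ← hM.degree_eq v, ← sum_degreeIn_fiber Finset.univ c v]
    rfl
  exact ((Finset.sum_eq_sum_iff_of_le hge).1 hsum a (Finset.mem_univ a)).symm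

lemma isHole_of_adj (hM : M.IsCritical T) (h : M.IsHole T c v) (hc : c u = c v)
    (hvu : M.mult v u ≠ 0) : M.IsHole T c u := by
  refine h.move (ne_of_mult_ne_zero hvu).symm ?_
  have hadd := degreeIn_erase_add (M := M) (mem_colorClass.2 hc) v
  rw [hM.degreeIn_colorClass h] at hadd
  lia

lemma isHole_of_mem (hM : M.IsCritical T) (h : M.IsHole T c v) (hx : x ∈ M.component c v) :
    M.IsHole T c x :=
  component_induction (p := M.IsHole T c) h (fun _ _ => hM.isHole_of_adj) hx

lemma degreeIn_component (hM : M.IsCritical T) (h : M.IsHole T c v)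
    (hx : x ∈ M.component c v) : M.degreeIn (M.component c v) x = T (c v) := by
  rw [← hM.degreeIn_colorClass (hM.isHole_of_mem h hx) (c v)]
  refine degreeIn_congr fun y hy => ⟨fun hyv => ?_, fun hyv => ?_⟩
  · exact mem_colorClass.2 (color_eq_of_mem_component hyv)
  · exact mem_component_of_adj hx
      ((mem_colorClass.1 hyv).trans (color_eq_of_mem_component hx).symm) hy

lemma exists_adj_component (hM : M.IsCritical T) (h : M.IsHole T c v) :
    ∃ u ∈ M.component c v, M.mult v u ≠ 0 :=
  exists_adj_of_degreeIn_pos <| by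
    rw [hM.degreeIn_component h (self_mem_component c v)]
    exact hM.pos _

lemma mult_eq_of_swap (hM : M.IsCritical T) (h : M.IsHole T c v)
    (hw : w ∈ M.component (flip c v) v) (hwv : w ≠ v) (hx : x ∈ M.component c v)
    (hx' : x ∈ M.component (flip (flip c v) w) w) : M.mult x w = M.mult x v := by
  have hcw : c w = !c v := color_of_mem_component_flip hw hwv
  have hole' : M.IsHole T (flip (flip c v) w) w :=
    isHole_flip.2 (hM.isHole_of_mem (isHole_flip.2 h) hw)
  -- The color class of the hole has changed exactly by exchanging `v` for `w`.
  have hclass : colorClass (flip (flip c v) w) (c v) =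
      insert w ((colorClass c (c v)).erase v) := by
    ext y
    by_cases hyw : y = w
    · simp [hyw, flip_of_ne _ hwv, hcw]
    · by_cases hyv : y = v
      · simp [hyv, flip_of_ne _ hwv.symm, hwv.symm]
      · simp [flip_of_ne _ hyw, flip_of_ne _ hyv, hyw, hyv]
  have hw_notMem : w ∉ (colorClass c (c v)).erase v := by simp [hcw]
  have hdeg := hM.degreeIn_colorClass (hM.isHole_of_mem h hx) (c v)
  have hdeg' := hM.degreeIn_colorClass (hM.isHole_of_mem hole' hx') (c v)
  rw [hclass, degreeIn_insert hw_notMem] at hdeg'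
  have hadd := degreeIn_erase_add (M := M) (A := colorClass c (c v)) (x := v) (by simp) x
  lia

end IsCritical

/-- The components of the hole `v` in the two colors remain connected when `v` is deleted, and are
then joined by the edge `uw`. -/
structure AdjacentComponents (M : EdgeMult V) (T : Bool → ℕ) (c : V → Bool) (v u w : V) :
    Prop where
  hole : M.IsHole T c v
  left : M.IsConnectedOn ((M.component c v).erase v)
  right : M.IsConnectedOn ((M.component (flip c v) v).erase v)
  mem_left : u ∈ (M.component c v).erase v
  mem_right : w ∈ (M.component (flip c v) v).erase v
  adj : M.mult u w ≠ 0

namespace AdjacentComponents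

lemma symm (h : M.AdjacentComponents T c v u w) :
    M.AdjacentComponents T (flip c v) v w u where
  hole := isHole_flip.2 h.hole
  left := h.right
  right := by simpa using h.left
  mem_left := h.mem_right
  mem_right := by simpa using h.mem_left
  adj := by
    rw [M.symm]
    exact h.adj

lemma mult_right_eq (hM : M.IsCritical T) (h : M.AdjacentComponents T c v u w)
    (hx : x ∈ (M.component c v).erase v) : M.mult x w = M.mult x v := by
  obtain ⟨hwv, hw⟩ := Finset.mem_erase.1 h.mem_right
  have hcw : c w = !c v := color_of_mem_component_flip hw hwv
  have hcolor : ∀ z ∈ (M.component c v).erase v, flip (flip c v) w z = c v := by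
    intro z hz
    by_cases hzw : z = w
    · simp [hzw, flip_of_ne _ hwv, hcw]
    · rw [flip_of_ne _ hzw, flip_of_ne _ (Finset.ne_of_mem_erase hz),
        color_eq_of_mem_component (Finset.mem_of_mem_erase hz)]
  have hcolor_w : flip (flip c v) w w = c v := by simp [flip_of_ne _ hwv, hcw]
  refine hM.mult_eq_of_swap h.hole hw hwv (Finset.mem_of_mem_erase hx)
    (h.left.subset_component h.mem_left ?_ (by simpa only [hcolor_w] using hcolor) hx)
  refine mem_component_of_adj (self_mem_component _ _)
    ((hcolor u h.mem_left).trans hcolor_w.symm) ?_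
  rw [M.symm]
  exact h.adj

lemma mult_hole_eq (hM : M.IsCritical T) (h : M.AdjacentComponents T c v u w)
    (hx : x ∈ (M.component c v).erase v) (hxv : M.mult x v ≠ 0) : M.mult x v = M.mult u w := by
  have hxw : M.mult x w = M.mult x v := h.mult_right_eq hM hx
  have h' : M.AdjacentComponents T c v x w := { h with mem_left := hx, adj := by rwa [hxw] }
  calc M.mult x v = M.mult w x := by rw [← hxw, M.symm]
    _ = M.mult w v := h'.symm.mult_right_eq hM h.mem_right
    _ = M.mult w u := (h.symm.mult_right_eq hM h.mem_right).symm
    _ = M.mult u w := M.symm w u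

lemma mult_neighbors_eq (hM : M.IsCritical T) (h : M.AdjacentComponents T c v u w)
    (hx : x ∈ (M.component c v).erase v) (hxv : M.mult x v ≠ 0)
    (hy : y ∈ (M.component c v).erase v) (hyv : M.mult y v ≠ 0) (hxy : x ≠ y) :
    M.mult x y = M.mult u w := by
  obtain ⟨hwv, hw⟩ := Finset.mem_erase.1 h.mem_right
  have hcw : c w = !c v := color_of_mem_component_flip hw hwv
  have hxK := Finset.mem_of_mem_erase hx
  have hyK := Finset.mem_of_mem_erase hy
  have hcx : c x = c v := color_eq_of_mem_component hxK
  have hcy : c y = c v := color_eq_of_mem_component hyK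
  have hwx : w ≠ x := fun hwx => by simp [hwx, hcx] at hcw
  have hyw : y ≠ w := fun hyw => by simp [← hyw, hcy] at hcw
  -- Move the hole to `x` and exchange `x` for `w`.
  have hswap : M.mult y w = M.mult y x := by
    refine hM.mult_eq_of_swap (hM.isHole_of_mem h.hole hxK) ?_ hwx
      (by rwa [component_eq_of_mem hxK]) ?_
    · refine mem_component_of_adj (self_mem_component _ _) (by simp [flip_of_ne _ hwx, hcw, hcx]) ?_
      rwa [h.mult_right_eq hM hx]
    · refine mem_component_of_adj (self_mem_component _ _)
        (by simp [flip_of_ne, hyw, hwx, hxy.symm, hcw, hcy]) ?_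
      rwa [M.symm, h.mult_right_eq hM hy]
  rw [M.symm, ← hswap, h.mult_right_eq hM hy, h.mult_hole_eq hM hy hyv]

lemma uniform_left (hM : M.IsCritical T) (h : M.AdjacentComponents T c v u w) :
    M.IsUniformOn (M.mult u w) (M.component c v) := by
  set K := M.component c v
  set P := insert v {x ∈ K.erase v | M.mult x v ≠ 0} with hP
  have hvK : v ∈ K := self_mem_component c v
  have hPK : P ⊆ K := Finset.insert_subset hvK
    ((Finset.filter_subset _ _).trans (Finset.erase_subset _ _))
  have hPuniform : M.IsUniformOn (M.mult u w) P := by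
    intro x hx y hy hxy
    simp only [hP, Finset.mem_insert, Finset.mem_filter] at hx hy
    rcases hx with rfl | ⟨hxK, hxv⟩ <;> rcases hy with rfl | ⟨hyK, hyv⟩
    · exact absurd rfl hxy
    · rw [M.symm]
      exact h.mult_hole_eq hM hyK hyv
    · exact h.mult_hole_eq hM hxK hxv
    · exact h.mult_neighbors_eq hM hxK hxv hyK hyv hxy
  have hvP : v ∈ P := Finset.mem_insert_self _ _
  have hdeg : M.degreeIn P v = T (c v) := by
    rw [← hM.degreeIn_component h.hole hvK]
    refine degreeIn_congr fun z hz => ⟨fun hzP => hPK hzP, fun hzK => ?_⟩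
    exact Finset.mem_insert_of_mem (Finset.mem_filter.2
      ⟨Finset.mem_erase.2 ⟨(ne_of_mult_ne_zero hz).symm, hzK⟩, by rwa [M.symm]⟩)
  -- All vertices of `P` have full degree inside `P`, so the component cannot leave `P`.
  refine hPuniform.mono ((isConnectedOn_component c v).subset_of_closed hvK hvP
    fun y hy hyP z hz hyz => mem_of_degreeIn_le hPK ?_ hz hyz)
  rw [hM.degreeIn_component h.hole hy, hPuniform.degreeIn_eq hyP, ← hPuniform.degreeIn_eq hvP,
    hdeg]

lemma uniform_union (hM : M.IsCritical T) (h : M.AdjacentComponents T c v u w) :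
    M.IsUniformOn (M.mult u w) (M.component c v ∪ M.component (flip c v) v) := by
  have hleft := h.uniform_left hM
  have hright : M.IsUniformOn (M.mult u w) (M.component (flip c v) v) := by
    rw [M.symm u w]
    exact h.symm.uniform_left hM
  refine hleft.union hright fun x hx y hy hxy => ?_
  by_cases hxv : x = v
  · subst hxv
    exact hright x (self_mem_component _ _) y hy hxy
  by_cases hyv : y = v
  · subst hyv
    exact hleft x hx y (self_mem_component _ _) hxy
  have hxv' : M.mult x v = M.mult u w := hleft x hx v (self_mem_component c v) hxv
  have hyv' : M.mult y v = M.mult u w := hright y hy v (self_mem_component _ v) hyv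
  have hyu : M.mult y u = M.mult y v := h.symm.mult_right_eq hM (Finset.mem_erase.2 ⟨hyv, hy⟩)
  have h' : M.AdjacentComponents T c v u y :=
    { h with
      mem_right := Finset.mem_erase.2 ⟨hyv, hy⟩
      adj := by
        rw [M.symm, hyu, hyv']
        exact h.adj }
  rw [h'.mult_right_eq hM (Finset.mem_erase.2 ⟨hxv, hx⟩), hxv']

lemma uniform_univ (hM : M.IsCritical T) (h : M.AdjacentComponents T c v u w) :
    M.IsUniformOn (M.mult u w) Finset.univ := by
  set B := M.component c v ∪ M.component (flip c v) v
  have hunion : M.IsUniformOn (M.mult u w) B := h.uniform_union hM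
  have hvB : v ∈ B := Finset.mem_union_left _ (self_mem_component c v)
  have hv : M.degreeIn B v = M.degreeIn Finset.univ v :=
    degreeIn_congr fun x hvx => iff_of_true (mem_component_union hvx) (Finset.mem_univ x)
  -- By uniformity all vertices of `B` have as large a degree in `B` as `v`, so no edge leaves `B`.
  refine hunion.mono (hM.connected.subset_of_closed (Finset.mem_univ v) hvB fun y _ hy z hz =>
    mem_of_degreeIn_le (Finset.subset_univ B) ?_ hz)
  rw [hM.degree_eq y, ← hM.degree_eq v, ← hv, hunion.degreeIn_eq hvB, hunion.degreeIn_eq hy]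

end AdjacentComponents

end Critical

section Trail

variable {V : Type*} [Fintype V] {M : EdgeMult V} {T : Bool → ℕ} {v : ℕ → V} {c : ℕ → V → Bool}
  {i k l m n : ℕ} {u w w' x y : V}

/-- A trail of holes: the hole of `c n` is `v n`; it is moved to a non-separating vertex `v (n + 1)`
of its component, whose color is then exchanged. -/
structure IsTrail (M : EdgeMult V) (T : Bool → ℕ) (v : ℕ → V) (c : ℕ → V → Bool) : Prop where
  hole : ∀ n, M.IsHole T (c n) (v n)
  mem : ∀ n, v (n + 1) ∈ M.component (c n) (v n)
  ne : ∀ n, v (n + 1) ≠ v n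
  connected : ∀ n, M.IsConnectedOn ((M.component (c n) (v n)).erase (v (n + 1)))
  step : ∀ n, c (n + 1) = flip (c n) (v (n + 1))

/-- What is left of the component of the `n`-th hole when the trail moves on. -/
def remnant (M : EdgeMult V) (v : ℕ → V) (c : ℕ → V → Bool) (n : ℕ) : Finset V :=
  (M.component (c n) (v n)).erase (v (n + 1))

lemma mem_component_of_mem_remnant (hx : x ∈ M.remnant v c n) :
    x ∈ M.component (c n) (v n) :=
  Finset.mem_of_mem_erase hx

namespace IsTrail

lemma color_succ_of_ne (h : M.IsTrail T v c) (hx : x ≠ v (n + 1)) : c (n + 1) x = c n x := by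
  rw [h.step, flip_of_ne _ hx]

lemma color_next (h : M.IsTrail T v c) (n : ℕ) : c n (v (n + 1)) = c n (v n) :=
  color_eq_of_mem_component (h.mem n)

lemma color_succ (h : M.IsTrail T v c) (n : ℕ) : c (n + 1) (v (n + 1)) = !c n (v n) := by
  rw [h.step, flip_self, h.color_next]

lemma component_next (h : M.IsTrail T v c) (n : ℕ) :
    M.component (c n) (v (n + 1)) = M.component (c n) (v n) :=
  component_eq_of_mem (h.mem n)

lemma self_mem_remnant (h : M.IsTrail T v c) (n : ℕ) : v n ∈ M.remnant v c n :=
  Finset.mem_erase.2 ⟨(h.ne n).symm, self_mem_component _ _⟩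

end IsTrail

/-- The component of the hole at time `k + 1` is the first one of the trail to meet the remnant of
an earlier component, namely the one at time `i`. -/
structure FirstReturn (M : EdgeMult V) (T : Bool → ℕ) (v : ℕ → V) (c : ℕ → V → Bool) (i k : ℕ) :
    Prop where
  trail : M.IsTrail T v c
  disjoint : ∀ m ≤ k, ∀ l < m, Disjoint (M.remnant v c l) (M.component (c m) (v m))
  le : i ≤ k
  hit : ¬ Disjoint (M.remnant v c i) (M.component (c (k + 1)) (v (k + 1)))

lemma IsTrail.exists_firstReturn (h : M.IsTrail T v c) :
    ∃ i k, M.FirstReturn T v c i k := by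
  have hex : ∃ m, ∃ l < m, ¬ Disjoint (M.remnant v c l) (M.component (c m) (v m)) := by
    obtain ⟨l, m, hlm, hv⟩ := Set.finite_univ.exists_lt_map_eq_of_forall_mem fun n =>
      Set.mem_univ (v n)
    exact ⟨m, l, hlm, Finset.not_disjoint_iff.2
      ⟨v l, h.self_mem_remnant l, hv ▸ self_mem_component _ _⟩⟩
  obtain ⟨i, hi, hhit⟩ := Nat.find_spec hex
  have hpos : Nat.find hex - 1 + 1 = Nat.find hex := Nat.sub_add_cancel (by lia)
  refine ⟨i, Nat.find hex - 1, h, fun m hm l hlm => ?_, by lia, by rwa [hpos]⟩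
  by_contra hmeet
  exact Nat.find_min hex (by lia) ⟨l, hlm, hmeet⟩

namespace FirstReturn

lemma notMem (R : M.FirstReturn T v c i k) (hlm : l < m) (hm : m ≤ k)
    (hx : x ∈ M.remnant v c l) : x ∉ M.component (c m) (v m) :=
  Finset.disjoint_left.1 (R.disjoint m hm l hlm) hx

lemma color_remnant (R : M.FirstReturn T v c i k) (hlm : l < m) (hm : m ≤ k + 1)
    (hx : x ∈ M.remnant v c l) : c m x = c l (v l) := by
  induction m, Nat.succ_le_of_lt hlm using Nat.le_induction with
  | base =>
    rw [Nat.succ_eq_add_one, R.trail.color_succ_of_ne (Finset.ne_of_mem_erase hx)]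
    exact color_eq_of_mem_component (mem_component_of_mem_remnant hx)
  | succ m hlm' ih =>
    have hxv : x ≠ v (m + 1) := fun h => R.notMem hlm' (by lia) hx (h ▸ R.trail.mem m)
    rw [R.trail.color_succ_of_ne hxv]
    exact ih hlm' (by lia)

lemma mult_eq_zero (R : M.FirstReturn T v c i k) (hlm : l < m) (hm : m ≤ k)
    (hx : x ∈ M.remnant v c l) (hy : y ∉ M.remnant v c l) (hcy : c m y = c l (v l)) :
    M.mult x y = 0 := by
  by_contra hxy
  induction m, Nat.succ_le_of_lt hlm using Nat.le_induction with
  | base =>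
    have hyv : y ≠ v (l + 1) := by
      rintro rfl
      simp [R.trail.color_succ] at hcy
    rw [Nat.succ_eq_add_one, R.trail.color_succ_of_ne hyv] at hcy
    have hxK := mem_component_of_mem_remnant hx
    exact hy (Finset.mem_erase.2 ⟨hyv,
      mem_component_of_adj hxK (hcy.trans (color_eq_of_mem_component hxK).symm) hxy⟩)
  | succ m hlm' ih =>
    by_cases hyv : y = v (m + 1)
    · subst hyv
      refine R.notMem hlm hm hx (mem_component_of_adj (self_mem_component _ _) ?_ ?_)
      · rw [hcy, R.color_remnant hlm (by lia) hx]
      · rwa [M.symm]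
    · exact ih hlm' (by lia) (by rwa [R.trail.color_succ_of_ne hyv] at hcy)

lemma color_eq (R : M.FirstReturn T v c i k) : c (k + 1) (v (k + 1)) = c i (v i) := by
  obtain ⟨x, hx, hx'⟩ := Finset.not_disjoint_iff.1 R.hit
  rw [← color_eq_of_mem_component hx',
    R.color_remnant (Nat.lt_succ_of_le R.le) le_rfl hx]

lemma color_last_hole (R : M.FirstReturn T v c i k) : c k (v k) = !c i (v i) := by
  rw [← R.color_eq, R.trail.color_succ, Bool.not_not]

lemma lt (R : M.FirstReturn T v c i k) : i < k :=
  R.le.lt_of_ne fun h => by simpa [h] using R.color_last_hole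

lemma succ_notMem (R : M.FirstReturn T v c i k) : v (k + 1) ∉ M.remnant v c i := fun h =>
  R.notMem R.lt le_rfl h (R.trail.mem k)

lemma mult_remnant_eq_zero (R : M.FirstReturn T v c i k) (hx : x ∈ M.remnant v c i)
    (hy : y ∉ M.remnant v c i) (hyv : y ≠ v (k + 1)) (hcy : c (k + 1) y = c i (v i)) :
    M.mult x y = 0 :=
  R.mult_eq_zero R.lt le_rfl hx hy (by rwa [← R.trail.color_succ_of_ne hyv])

lemma remnant_subset (R : M.FirstReturn T v c i k) :
    M.remnant v c i ⊆ M.component (c (k + 1)) (v (k + 1)) := by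
  obtain ⟨x, hx, hx'⟩ := Finset.not_disjoint_iff.1 R.hit
  refine (R.trail.connected i).subset_component hx hx' fun y hy => ?_
  rw [R.color_remnant (Nat.lt_succ_of_lt R.lt) le_rfl hy, R.color_eq]

lemma hole_ne (R : M.FirstReturn T v c i k) (hm : m ≤ k) : v m ≠ v (k + 1) := by
  intro h
  rcases hm.lt_or_eq with hlt | rfl
  · exact R.notMem hlt le_rfl (R.trail.self_mem_remnant m) (h ▸ R.trail.mem k)
  · exact R.trail.ne m h.symm

lemma color_last (R : M.FirstReturn T v c i k) (hm : m ≤ k) :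
    c m (v (k + 1)) = c k (v k) := by
  induction hm using Nat.decreasingInduction with
  | self => exact R.trail.color_next k
  | of_succ m hm ih => rw [← ih, R.trail.color_succ_of_ne (R.hole_ne hm).symm]

lemma mult_succ_eq (R : M.FirstReturn T v c i k) (hM : M.IsCritical T)
    (hx : x ∈ M.remnant v c i) : M.mult x (v (k + 1)) = M.mult x (v (i + 1)) := by
  have hbefore : M.degreeIn (M.remnant v c i) x + M.mult x (v (i + 1)) = T (c i (v i)) :=
    (degreeIn_erase_add (R.trail.mem i) x).trans
      (hM.degreeIn_component (R.trail.hole i) (mem_component_of_mem_remnant hx))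
  have hafter : M.degreeIn (insert (v (k + 1)) (M.remnant v c i)) x = T (c i (v i)) := by
    rw [← hM.degreeIn_colorClass (hM.isHole_of_mem (R.trail.hole (k + 1)) (R.remnant_subset hx))
      (c i (v i))]
    refine degreeIn_congr fun y hy => ?_
    rw [mem_colorClass, Finset.mem_insert]
    refine ⟨?_, fun hcy => ?_⟩
    · rintro (rfl | hyR)
      · exact R.color_eq
      · exact R.color_remnant (Nat.lt_succ_of_lt R.lt) le_rfl hyR
    · by_contra! hy'
      exact hy (R.mult_remnant_eq_zero hx hy'.2 hy'.1 hcy)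
  rw [degreeIn_insert R.succ_notMem] at hafter
  lia

lemma component_erase_eq (R : M.FirstReturn T v c i k) (hM : M.IsCritical T) :
    (M.component (c (k + 1)) (v (k + 1))).erase (v (k + 1)) = M.remnant v c i := by
  refine (Finset.subset_insert_iff.1 ?_).antisymm
    (Finset.subset_erase.2 ⟨R.remnant_subset, R.succ_notMem⟩)
  refine (isConnectedOn_component _ _).subset_of_closed (self_mem_component _ _)
    (Finset.mem_insert_self _ _) fun y hy hyR z hz hyz => ?_
  rcases Finset.mem_insert.1 hyR with rfl | hyR
  · have hdeg : M.degreeIn (M.remnant v c i) (v (i + 1)) =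
        M.degreeIn (M.remnant v c i) (v (k + 1)) :=
      Finset.sum_congr rfl fun x hx => by rw [M.symm, ← R.mult_succ_eq hM hx, M.symm]
    refine Finset.mem_insert_of_mem (mem_of_degreeIn_le R.remnant_subset ?_ hz hyz)
    rw [← hdeg, hM.degreeIn_component (R.trail.hole (k + 1)) hy, remnant, degreeIn_erase_self,
      hM.degreeIn_component (R.trail.hole i) (R.trail.mem i), R.color_eq]
  · by_contra hzR
    rw [Finset.mem_insert, not_or] at hzR
    exact hyz (R.mult_remnant_eq_zero hyR hzR.2 hzR.1
      ((color_eq_of_mem_component hz).trans R.color_eq))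

lemma uniform_univ (R : M.FirstReturn T v c i k) (hM : M.IsCritical T)
    (hu : u ∈ M.remnant v c i) (hw : w ∈ M.remnant v c k) (huw : M.mult u w ≠ 0) :
    M.IsUniformOn (M.mult u w) Finset.univ := by
  have hleft := R.component_erase_eq hM
  have hright : (M.component (flip (c (k + 1)) (v (k + 1))) (v (k + 1))).erase (v (k + 1)) =
      M.remnant v c k := by
    rw [R.trail.step, flip_flip, R.trail.component_next, remnant]
  have hadj : M.AdjacentComponents T (c (k + 1)) (v (k + 1)) u w :=
    { hole := R.trail.hole (k + 1)
      left := hleft ▸ R.trail.connected i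
      right := hright ▸ R.trail.connected k
      mem_left := hleft ▸ hu
      mem_right := hright ▸ hw
      adj := huw }
  exact hadj.uniform_univ hM

lemma neighbor_unique (R : M.FirstReturn T v c i k) (hM : M.IsCritical T) (hik : i + 1 < k)
    (hw : w ∈ M.remnant v c i) (hvw : M.mult (v (i + 1)) w ≠ 0)
    (hw' : w' ∈ M.remnant v c i) (hvw' : M.mult (v (i + 1)) w' ≠ 0) : w' = w := by
  by_contra hne
  have hwK := mem_component_of_mem_remnant hw
  have hcw : c i w = c i (v i) := color_eq_of_mem_component hwK
  have hcw' : c i w' = c i (v i) :=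
    color_eq_of_mem_component (mem_component_of_mem_remnant hw')
  have hkw : v (k + 1) ≠ w := fun h => R.succ_notMem (h ▸ hw)
  have hkw' : v (k + 1) ≠ w' := fun h => R.succ_notMem (h ▸ hw')
  have hiw : v (i + 1) ≠ w := (Finset.ne_of_mem_erase hw).symm
  have hik' : v (i + 1) ≠ v (k + 1) := R.hole_ne hik.le
  have hck : c i (v (k + 1)) = !c i (v i) := by rw [R.color_last R.le, R.color_last_hole]
  -- Move the hole from `v i` to `w` and exchange `w` for `v (k + 1)`; through `w'`, the vertex
  -- `v (i + 1)` remains in the component of the hole.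
  have hswap : M.mult (v (i + 1)) (v (k + 1)) = M.mult (v (i + 1)) w := by
    refine hM.mult_eq_of_swap (hM.isHole_of_mem (R.trail.hole i) hwK) ?_ hkw
      (by simpa only [component_eq_of_mem hwK] using R.trail.mem i) ?_
    · refine mem_component_of_adj (self_mem_component _ _) ?_ ?_
      · rw [flip_of_ne _ hkw, hck, flip_self, hcw]
      · rwa [R.mult_succ_eq hM hw, M.symm]
    · refine mem_component_of_adj (x := w')
        (mem_component_of_adj (self_mem_component _ _) ?_ ?_) ?_ ?_
      · simp [flip_of_ne, hkw, hkw'.symm, hne, hck, hcw']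
      · rwa [M.symm, R.mult_succ_eq hM hw', M.symm]
      · simp [flip_of_ne, hkw'.symm, hne, hiw, hik', hcw', R.trail.color_next]
      · rwa [M.symm]
  have hmem : v (i + 1) ∈ M.component (c k) (v (k + 1)) := by
    refine mem_component_of_adj (self_mem_component _ _) ?_ ?_
    · rw [R.color_remnant hik (Nat.le_succ k) (R.trail.self_mem_remnant _), R.color_last le_rfl,
        R.trail.color_succ, R.color_last_hole]
    · rwa [M.symm, hswap]
  rw [R.trail.component_next] at hmem
  exact R.notMem hik le_rfl (R.trail.self_mem_remnant _) hmem

lemma mult_eq_and_component_subset (R : M.FirstReturn T v c i k) (hM : M.IsCritical T)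
    (hfar : ∀ u ∈ M.remnant v c i, ∀ w ∈ M.remnant v c k, M.mult u w = 0) :
    M.mult (v (i + 1)) (v i) = T (c i (v i)) ∧ M.component (c i) (v i) ⊆ {v i, v (i + 1)} := by
  have hdeg : M.degreeIn (M.remnant v c i) (v (i + 1)) = T (c i (v i)) := by
    rw [remnant, degreeIn_erase_self, hM.degreeIn_component (R.trail.hole i) (R.trail.mem i)]
  obtain ⟨w, hw, hvw⟩ := exists_adj_of_degreeIn_pos (hdeg.symm ▸ hM.pos _)
  have hik : i + 1 < k := by
    refine lt_of_le_of_ne R.lt fun h => hvw ?_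
    rw [M.symm]
    exact hfar w hw _ (h ▸ R.trail.self_mem_remnant (i + 1))
  have hmult : M.mult (v (i + 1)) w = T (c i (v i)) := by
    rw [← hdeg]
    refine (Finset.sum_eq_single_of_mem w hw fun z hz hzw => ?_).symm
    by_contra hvz
    exact hzw (R.neighbor_unique hM hik hw hvw hz hvz)
  have hpair : M.component (c i) (v i) ⊆ {w, v (i + 1)} := by
    refine (isConnectedOn_component _ _).subset_of_closed (x := v (i + 1)) (R.trail.mem i) (by simp)
      fun y hy hyp z hz hyz => ?_
    rw [Finset.mem_insert, Finset.mem_singleton] at hyp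
    rcases hyp with rfl | rfl
    · refine Finset.mem_insert_of_mem
        (mem_of_degreeIn_le (Finset.singleton_subset_iff.2 (R.trail.mem i)) ?_ hz hyz)
      rw [hM.degreeIn_component (R.trail.hole i) hy, degreeIn, Finset.sum_singleton, M.symm, hmult]
    · have hzR : z ∈ M.remnant v c i := Finset.mem_erase.2 ⟨(ne_of_mult_ne_zero hyz).symm, hz⟩
      exact Finset.mem_insert.2 (.inl (R.neighbor_unique hM hik hw hvw hzR hyz))
  have hwv : v i = w := (Finset.mem_insert.1 (hpair (self_mem_component _ _))).resolve_right
    fun h => R.trail.ne i (Finset.mem_singleton.1 h).symm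
  subst hwv
  exact ⟨hmult, hpair⟩

lemma eq_zero (R : M.FirstReturn T v c i k) (hM : M.IsCritical T)
    (hmult : M.mult (v (i + 1)) (v i) ≠ 0) : i = 0 := by
  by_contra hi
  obtain ⟨l, rfl⟩ := Nat.exists_eq_succ_of_ne_zero hi
  have hlk : l < k := (Nat.lt_succ_self l).trans R.lt
  have hmem : v (k + 1) ∈ M.component (c l) (v (l + 1)) := by
    refine mem_component_of_adj (self_mem_component _ _) ?_ ?_
    · rw [R.color_last hlk.le, R.trail.color_next]
      rw [R.color_last_hole, R.trail.color_succ, Bool.not_not]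
    · rwa [R.mult_succ_eq hM (R.trail.self_mem_remnant _), M.symm]
  rw [R.trail.component_next] at hmem
  exact R.notMem hlk le_rfl
    (Finset.mem_erase.2 ⟨(R.hole_ne (m := l + 1) R.le).symm, hmem⟩) (R.trail.mem k)

lemma card_component_zero (R : M.FirstReturn T v c i k) (hM : M.IsCritical T)
    (hfar : ∀ u ∈ M.remnant v c i, ∀ w ∈ M.remnant v c k, M.mult u w = 0) :
    (M.component (c 0) (v 0)).card = 2 := by
  obtain ⟨hmult, hpair⟩ := R.mult_eq_and_component_subset hM hfar
  obtain rfl := R.eq_zero hM (hmult ▸ (hM.pos _).ne')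
  have hpair' : {v 0, v (0 + 1)} ⊆ M.component (c 0) (v 0) :=
    Finset.insert_subset (self_mem_component _ _) (Finset.singleton_subset_iff.2 (R.trail.mem 0))
  rw [hpair.antisymm hpair', Finset.card_pair (R.trail.ne 0).symm]

end FirstReturn

namespace IsCritical

variable {e : V → Bool}

lemma exists_trail_step (hM : M.IsCritical T) (h : M.IsHole T e x) :
    ∃ y, M.IsHole T (flip e y) y ∧ y ∈ M.component e x ∧ y ≠ x ∧
      M.IsConnectedOn ((M.component e x).erase y) := by
  have hne : M.component e x ≠ {x} := by
    intro heq
    obtain ⟨u, hu, hxu⟩ := hM.exists_adj_component h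
    rw [heq, Finset.mem_singleton] at hu
    exact ne_of_mult_ne_zero hxu hu.symm
  obtain ⟨y, hy, hyx, hconn⟩ :=
    (isConnectedOn_component e x).exists_erase (self_mem_component e x) hne
  exact ⟨y, isHole_flip.2 (hM.isHole_of_mem h hy), hy, hyx, hconn⟩

lemma exists_trail (hM : M.IsCritical T) (h : M.IsHole T e x) :
    ∃ v c, v 0 = x ∧ c 0 = e ∧ M.IsTrail T v c := by
  let State := {p : V × (V → Bool) // M.IsHole T p.2 p.1}
  have hstep : ∀ p : State, ∃ q : State,
      q.1.1 ∈ M.component p.1.2 p.1.1 ∧ q.1.1 ≠ p.1.1 ∧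
      M.IsConnectedOn ((M.component p.1.2 p.1.1).erase q.1.1) ∧ q.1.2 = flip p.1.2 q.1.1 := by
    rintro ⟨⟨x, e⟩, hhole⟩
    obtain ⟨y, hhole', hy, hyx, hconn⟩ := hM.exists_trail_step hhole
    exact ⟨⟨(y, flip e y), hhole'⟩, hy, hyx, hconn, rfl⟩
  choose next hnext using hstep
  let q : ℕ → State := fun n => next^[n] ⟨(x, e), h⟩
  have hq : ∀ n, q (n + 1) = next (q n) := fun n => Function.iterate_succ_apply' next n _
  refine ⟨fun n => (q n).1.1, fun n => (q n).1.2, rfl, rfl, fun n => (q n).2,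
    fun n => ?_, fun n => ?_, fun n => ?_, fun n => ?_⟩ <;> simp only [hq]
  exacts [(hnext (q n)).1, (hnext (q n)).2.1, (hnext (q n)).2.2.1, (hnext (q n)).2.2.2]

theorem uniform_or_card_component_eq_two (hM : M.IsCritical T) (h : M.IsHole T e x) :
    (∃ s, 0 < s ∧ M.IsUniformOn s Finset.univ) ∨ (M.component e x).card = 2 := by
  obtain ⟨v, c, rfl, rfl, htrail⟩ := hM.exists_trail h
  obtain ⟨i, k, R⟩ := htrail.exists_firstReturn
  by_cases hfar : ∀ u ∈ M.remnant v c i, ∀ w ∈ M.remnant v c k, M.mult u w = 0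
  · exact .inr (R.card_component_zero hM hfar)
  · push Not at hfar
    obtain ⟨u, hu, w, hw, huw⟩ := hfar
    exact .inl ⟨_, Nat.pos_of_ne_zero huw, R.uniform_univ hM hu hw huw⟩

end IsCritical

end Trail

section Colorable

variable {V Γ : Type*} {M : EdgeMult V} {t s k r : ℕ} {A B : Finset V} {v x y : V}

lemma IsConnectedOn.exists_degreeIn_lt (hA : M.IsConnectedOn A)
    (hle : ∀ x ∈ A, M.degreeIn A x ≤ r) (hB : B ⊆ A) (hn : B.Nonempty) (hne : B ≠ A) :
    ∃ x ∈ B, M.degreeIn B x < r := by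
  obtain ⟨x, hx, y, hy, hyB, hxy⟩ := hA.2 B hB hn hne
  refine ⟨x, hx, lt_of_not_ge fun hge => hyB ?_⟩
  exact mem_of_degreeIn_le hB ((hle x (hB hx)).trans hge) hy hxy

lemma IsConnectedOn.isDegenerateOn (hA : M.IsConnectedOn A) (hle : ∀ x ∈ A, M.degreeIn A x ≤ r)
    (hv : v ∈ A) (hlt : M.degreeIn A v < r) : M.IsDegenerateOn r A := by
  intro B hB hn
  by_cases hne : B = A
  · exact ⟨v, hne ▸ hv, hne ▸ hlt⟩
  · exact hA.exists_degreeIn_lt hle hB hn hne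

lemma IsDegenerateOn.mult_lt (h : M.IsDegenerateOn t A) (hx : x ∈ A) (hy : y ∈ A) :
    M.mult x y < t := by
  obtain ⟨z, hz, hlt⟩ := h {x, y} (by simp [Finset.insert_subset_iff, hx, hy]) (by simp)
  refine lt_of_le_of_lt ?_ hlt
  rcases Finset.mem_insert.1 hz with rfl | hz
  · exact Finset.single_le_sum_of_canonicallyOrdered (by simp)
  · rw [Finset.mem_singleton.1 hz, M.symm]
    exact Finset.single_le_sum_of_canonicallyOrdered (by simp)

variable [Fintype V]

lemma exists_isHole [Fintype Γ] [Nonempty Γ] {T : Γ → ℕ} (hconn : M.IsConnectedOn Finset.univ)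
    (hle : ∀ x, M.degreeIn Finset.univ x ≤ ∑ a, T a) (v : V) : ∃ c : V → Γ, M.IsHole T c v :=
  exists_isColoringOn fun B hB hn =>
    hconn.exists_degreeIn_lt (fun x _ => hle x) (Finset.subset_univ B) hn fun h =>
      Finset.notMem_erase v _ (hB (h ▸ Finset.mem_univ v))

/-- The vertices can be colored with `k` colors such that each color class induces a strictly
`t`-degenerate multigraph. -/
def IsColorable (M : EdgeMult V) (t k : ℕ) : Prop :=
  ∃ c : V → Fin k, M.IsColoringOn (fun _ => t) Finset.univ c

lemma IsColorable.mono {k' : ℕ} (h : M.IsColorable t k) (hk : k ≤ k') : M.IsColorable t k' := by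
  obtain ⟨c, hc⟩ := h
  refine ⟨fun x => Fin.castLE hk (c x), fun a B hB ⟨x, hx⟩ => ?_⟩
  have ha : ∀ y ∈ B, Fin.castLE hk (c y) = a := fun y hy => by simpa using hB hy
  have hsubset : B ⊆ colorClass c (c x) := fun y hy =>
    mem_colorClass.2 (Fin.castLE_injective hk ((ha y hy).trans (ha x hx).symm))
  exact hc (c x) B hsubset ⟨x, hx⟩

lemma isColorable_of_mult_eq_zero (ht : 0 < t) {c : V → Fin k}
    (h : ∀ x y, c x = c y → M.mult x y = 0) : M.IsColorable t k := by
  refine ⟨c, fun a B hB ⟨v, hv⟩ => ⟨v, hv, ?_⟩⟩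
  rw [degreeIn, Finset.sum_eq_zero fun x hx => ?_]
  · exact ht
  exact h v x ((mem_colorClass.1 (hB hv)).trans (mem_colorClass.1 (hB hx)).symm)

lemma isColorable_card (M : EdgeMult V) (ht : 0 < t) : M.IsColorable t (Fintype.card V) :=
  isColorable_of_mult_eq_zero ht (c := Fintype.equivFin V) fun x y hxy => by
    rw [(Fintype.equivFin V).injective hxy, M.loopless]

lemma IsDegenerateOn.isColorable (h : M.IsDegenerateOn ((k + 1) * t) Finset.univ) :
    M.IsColorable t (k + 1) :=
  exists_isColoringOn (by simpa using h)

lemma degreeIn_eq_of_not_isColorable (hconn : M.IsConnectedOn Finset.univ)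
    (hle : ∀ x, M.degreeIn Finset.univ x ≤ k * t) (h : ¬ M.IsColorable t k) (v : V) :
    M.degreeIn Finset.univ v = k * t := by
  refine (hle v).antisymm (le_of_not_gt fun hlt => h ?_)
  cases k with
  | zero => lia
  | succ k => exact (hconn.isDegenerateOn (fun x _ => hle x) (Finset.mem_univ v) hlt).isColorable

lemma le_card_neighbors (ht : 0 < t) (h : ¬ M.IsColorable t k) {c : V → Fin k}
    (hc : M.IsHole (fun _ => t) c v) : k ≤ ({x | M.mult v x ≠ 0} : Finset V).card := by
  have hsurj : Set.SurjOn c ({x | M.mult v x ≠ 0} : Finset V) (Finset.univ : Finset (Fin k)) := by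
    intro a _
    have hdeg : t ≤ M.degreeIn (colorClass c a) v :=
      le_of_not_gt fun hlt => h ⟨_, hc.isColoringOn_update hlt⟩
    obtain ⟨x, hx, hvx⟩ := exists_adj_of_degreeIn_pos (ht.trans_le hdeg)
    exact ⟨x, by simpa using hvx, mem_colorClass.1 hx⟩
  simpa using Finset.card_le_card_of_surjOn c hsurj

/-- The thresholds for two colors obtained from `k + 1` colors with threshold `t` by merging `k` of
them. -/
def mergedThreshold (t k : ℕ) : Bool → ℕ
  | true => t
  | false => k * t

lemma IsColoringOn.isColorable (hk : 0 < k) {c : V → Bool}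
    (h : M.IsColoringOn (mergedThreshold t k) Finset.univ c) : M.IsColorable t (k + 1) := by
  have : Nonempty (Fin k) := ⟨⟨0, hk⟩⟩
  have hmerged : M.IsDegenerateOn (∑ _a : Fin k, t) (colorClass c false) := by
    rw [Finset.sum_const, Finset.card_univ, Fintype.card_fin]
    exact h false
  obtain ⟨d, hd⟩ := exists_isColoringOn hmerged
  refine ⟨fun x => bif c x then 0 else (d x).succ, fun a => ?_⟩
  cases a using Fin.cases with
  | zero => exact (h true).mono fun x => by cases hx : c x <;> simp [hx]
  | succ a =>
    refine (hd a).mono fun x => ?_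
    cases hx : c x <;> simp [hx, (Fin.succ_ne_zero a).symm]

lemma isCritical_mergedThreshold (ht : 0 < t) (hk : 0 < k) (hconn : M.IsConnectedOn Finset.univ)
    (hle : ∀ x, M.degreeIn Finset.univ x ≤ (k + 1) * t) (h : ¬ M.IsColorable t (k + 1)) :
    M.IsCritical (mergedThreshold t k) where
  pos b := by cases b <;> simp [mergedThreshold, ht, hk]
  degree_eq v := by
    rw [degreeIn_eq_of_not_isColorable hconn hle h, mergedThreshold, mergedThreshold]
    ring
  connected := hconn
  not_isColoringOn c hc := h (hc.isColorable hk)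

end Colorable

namespace IsCritical

variable {V : Type*} [Fintype V] {M : EdgeMult V} {T : Bool → ℕ} {s : ℕ} {c : V → Bool}
  {x y : V}

lemma exists_isHole (hM : M.IsCritical T) (v : V) : ∃ c, M.IsHole T c v :=
  EdgeMult.exists_isHole hM.connected
    (fun x => by rw [hM.degree_eq, Fintype.sum_bool]) v

lemma dvd_of_isUniformOn (hM : M.IsCritical T) (hU : M.IsUniformOn s Finset.univ) (b : Bool) :
    s ∣ T b := by
  obtain ⟨v, -⟩ := hM.connected.1
  obtain ⟨c, hc⟩ := hM.exists_isHole v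
  have hdeg := hM.degreeIn_component ((isHole_update b).2 hc) (self_mem_component _ v)
  rw [(hU.mono (Finset.subset_univ _)).degreeIn_eq (self_mem_component _ v),
    Function.update_self] at hdeg
  exact ⟨_, hdeg.symm⟩

lemma mult_eq_of_card_component (hM : M.IsCritical T)
    (hpair : ∀ c v, M.IsHole T c v → (M.component c v).card = 2) (hxy : M.mult x y ≠ 0) :
    ∃ b, M.mult x y = T b := by
  obtain ⟨c, hc⟩ := hM.exists_isHole x
  set c' := Function.update c x (c y)
  have hc' : M.IsHole T c' x := (isHole_update _).2 hc
  have hne : x ≠ y := ne_of_mult_ne_zero hxy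
  have hx : x ∈ M.component c' x := self_mem_component c' x
  have hy : y ∈ M.component c' x := by
    refine mem_component_of_adj hx ?_ hxy
    simp [c', hne.symm]
  have hcomponent : {x, y} = M.component c' x :=
    Finset.eq_of_subset_of_card_le (by simp [Finset.insert_subset_iff, hx, hy])
      (by rw [hpair c' x hc', Finset.card_pair hne])
  refine ⟨c' x, ?_⟩
  rw [← hM.degreeIn_component hc' hx, ← hcomponent, degreeIn_insert_self, degreeIn,
    Finset.sum_singleton]

lemma card_neighbors_le_two (hM : M.IsCritical T)
    (hpair : ∀ c v, M.IsHole T c v → (M.component c v).card = 2) (v : V) :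
    ({x | M.mult v x ≠ 0} : Finset V).card ≤ 2 := by
  obtain ⟨c, hc⟩ := hM.exists_isHole v
  have hsubset : ({x | M.mult v x ≠ 0} : Finset V) ⊆
      (M.component c v).erase v ∪ (M.component (flip c v) v).erase v := by
    intro x hx
    have hvx : M.mult v x ≠ 0 := by simpa using hx
    rw [← Finset.erase_union_distrib]
    exact Finset.mem_erase.2 ⟨(ne_of_mult_ne_zero hvx).symm, mem_component_union hvx⟩
  refine (Finset.card_le_card hsubset).trans ((Finset.card_union_le _ _).trans ?_)
  rw [Finset.card_erase_of_mem (self_mem_component _ _),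
    Finset.card_erase_of_mem (self_mem_component _ _), hpair c v hc, hpair _ v (isHole_flip.2 hc)]

end IsCritical

end EdgeMult

section CycleGraph

variable {V : Type*} [Fintype V] {G : SimpleGraph V} {n : ℕ}

lemma exists_copy_cycleGraph (hconn : G.Connected) (hreg : G.IsRegularOfDegree 2) :
    ∃ n, 3 ≤ n ∧ Nonempty (SimpleGraph.Copy (SimpleGraph.cycleGraph n) G) := by
  have hnontrivial : Nontrivial V := by
    obtain ⟨v⟩ := hconn.nonempty
    obtain ⟨w, hvw⟩ := (G.degree_pos_iff_exists_adj v).1 (by rw [hreg.degree_eq]; norm_num)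
    exact ⟨v, w, hvw.ne⟩
  have hcyclic : ¬ G.IsAcyclic := fun hacyclic => by
    obtain ⟨v, hv⟩ :=
      SimpleGraph.IsTree.exists_vert_degree_one_of_nontrivial (G := G) ⟨hconn, hacyclic⟩
    rw [hreg.degree_eq] at hv
    lia
  simpa [SimpleGraph.isAcyclic_iff_free_cycleGraph, SimpleGraph.Free] using hcyclic

lemma exists_adj_of_copy_cycleGraph (hreg : G.IsRegularOfDegree 2) (hn : 3 ≤ n)
    (φ : SimpleGraph.Copy (SimpleGraph.cycleGraph n) G) {i : Fin n} {y : V} (h : G.Adj (φ i) y) :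
    ∃ j, (SimpleGraph.cycleGraph n).Adj i j ∧ φ j = y := by
  obtain ⟨m, rfl⟩ := Nat.exists_eq_add_of_le' hn
  have himage : ((SimpleGraph.cycleGraph (m + 3)).neighborFinset i).image φ =
      G.neighborFinset (φ i) := by
    refine Finset.eq_of_subset_of_card_le (fun z hz => ?_) ?_
    · obtain ⟨j, hj, rfl⟩ := Finset.mem_image.1 hz
      rw [SimpleGraph.mem_neighborFinset] at hj ⊢
      exact φ.toHom.map_adj hj
    · rw [Finset.card_image_of_injective (f := φ) _ φ.injective,
        SimpleGraph.card_neighborFinset_eq_degree, SimpleGraph.card_neighborFinset_eq_degree,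
        hreg.degree_eq]
      convert SimpleGraph.cycleGraph_degree_three_le.ge
  have hy : y ∈ G.neighborFinset (φ i) := by simpa using h
  simpa [← himage] using hy

theorem exists_iso_cycleGraph (hconn : G.Connected) (hreg : G.IsRegularOfDegree 2) :
    ∃ n, 3 ≤ n ∧ Nonempty (G ≃g SimpleGraph.cycleGraph n) := by
  obtain ⟨n, hn, ⟨φ⟩⟩ := exists_copy_cycleGraph hconn hreg
  have hsurj : Function.Surjective φ := by
    intro y
    induction (SimpleGraph.reachable_iff_reflTransGen _ _).1
      (hconn.preconnected (φ ⟨0, by lia⟩) y) with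
    | refl => exact ⟨_, rfl⟩
    | tail _ hadj ih =>
      obtain ⟨i, rfl⟩ := ih
      obtain ⟨j, -, hj⟩ := exists_adj_of_copy_cycleGraph hreg hn φ hadj
      exact ⟨j, hj⟩
  refine ⟨n, hn, ⟨RelIso.symm ⟨Equiv.ofBijective φ ⟨φ.injective, hsurj⟩, fun {i j} => ?_⟩⟩⟩
  refine ⟨fun h => ?_, fun h => φ.toHom.map_adj h⟩
  obtain ⟨j', hj', heq⟩ := exists_adj_of_copy_cycleGraph hreg hn φ h
  exact φ.injective heq ▸ hj'

end CycleGraph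

namespace EdgeMult

section Inflation

variable {V : Type*} {M : EdgeMult V} {G : SimpleGraph V} {s t : ℕ} {A : Finset V}

/-- The simple graph underlying a multigraph. -/
def support (M : EdgeMult V) : SimpleGraph V where
  Adj x y := M.mult x y ≠ 0
  symm := ⟨fun x y h => by rwa [M.symm]⟩
  loopless := ⟨fun x h => h (M.loopless x)⟩

/-- The multigraph is `sG`: each edge of the simple graph `G` is replaced by `s` parallel edges. -/
def IsInflation (M : EdgeMult V) (s : ℕ) (G : SimpleGraph V) : Prop :=
  ∀ x y, M.mult x y = if G.Adj x y then s else 0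

lemma isInflation_support (h : ∀ x y, M.mult x y ≠ 0 → M.mult x y = s) :
    M.IsInflation s M.support := by
  intro x y
  split_ifs with hxy
  · exact h x y hxy
  · exact not_not.1 hxy

lemma IsUniformOn.card_le_div (h : M.IsUniformOn s A) (hA : M.IsDegenerateOn t A) (hs : 0 < s)
    (hst : s ∣ t) : A.card ≤ t / s := by
  rcases A.eq_empty_or_nonempty with rfl | hn
  · simp
  obtain ⟨v, hv, hlt⟩ := hA A subset_rfl hn
  obtain ⟨q, rfl⟩ := hst
  rw [h.degreeIn_eq hv] at hlt
  rw [Nat.mul_div_cancel_left q hs]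
  have hq := Nat.lt_of_mul_lt_mul_left hlt
  lia

variable [Fintype V]

lemma degree_support (v : V) : M.support.degree v = ({x | M.mult v x ≠ 0} : Finset V).card := by
  rw [← SimpleGraph.card_neighborFinset_eq_degree]
  congr 1
  ext x
  rw [SimpleGraph.mem_neighborFinset, Finset.mem_filter_univ]
  rfl

lemma IsConnectedOn.connected_support (h : M.IsConnectedOn Finset.univ) : M.support.Connected := by
  obtain ⟨v, -⟩ := h.1
  refine { preconnected := fun x y => ?_, nonempty := ⟨v⟩ }
  have hreach : Finset.univ ⊆ ({z | M.support.Reachable x z} : Finset V) :=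
    h.subset_of_closed (Finset.mem_univ x) (by simp) fun z _ hz w _ hzw =>
      Finset.mem_filter.2 ⟨Finset.mem_univ w,
        (Finset.mem_filter.1 hz).2.trans (SimpleGraph.Adj.reachable hzw)⟩
  exact (Finset.mem_filter.1 (hreach (Finset.mem_univ y))).2

lemma IsInflation.degreeIn_eq (h : M.IsInflation s G) (v : V) :
    M.degreeIn Finset.univ v = G.degree v * s := by
  simp only [degreeIn, h v, ← Finset.sum_filter, Finset.sum_const, smul_eq_mul,
    ← SimpleGraph.card_neighborFinset_eq_degree, SimpleGraph.neighborFinset_eq_filter]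

lemma IsInflation.colorable_of_isColorable {k : ℕ} (h : M.IsInflation t G)
    (hc : M.IsColorable t k) : G.Colorable k := by
  obtain ⟨c, hc⟩ := hc
  refine ⟨SimpleGraph.Coloring.mk c fun {x y} hxy heq => ?_⟩
  have hlt := (hc (c x)).mult_lt (x := x) (y := y) (by simp) (by simp [heq])
  rw [h x y, if_pos hxy] at hlt
  exact hlt.false

lemma IsInflation.isColorable {k : ℕ} (h : M.IsInflation s G) (ht : 0 < t) (hG : G.Colorable k) :
    M.IsColorable t k := by
  obtain ⟨c⟩ := hG
  refine isColorable_of_mult_eq_zero (c := c) ht fun x y hxy => ?_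
  rw [h x y, if_neg fun hadj => c.valid hadj hxy]

end Inflation

/-- The graphs with `χ_t = ⌈Δ / t⌉ + 1`, indexed by the value `k` of `⌈Δ / t⌉`. -/
inductive IsExtremal {V : Type*} [Fintype V] (M : EdgeMult V) (t : ℕ) : ℕ → Prop
  | complete {s p : ℕ} (hs : 0 < s) (hst : s ∣ t) (hU : M.IsUniformOn s Finset.univ)
      (hcard : Fintype.card V = t / s * p + 1) : IsExtremal M t p
  | cycle {n : ℕ} {G : SimpleGraph V} (hn : 3 ≤ n) (hodd : Odd n)
      (f : G ≃g SimpleGraph.cycleGraph n) (h : M.IsInflation t G) : IsExtremal M t 2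
  | regular (h : ∀ v, M.degreeIn Finset.univ v = t) : IsExtremal M t 1

section Extremal

variable {V : Type*} [Fintype V] {M : EdgeMult V} {s t k p : ℕ}

lemma IsExtremal.degreeIn_eq (h : M.IsExtremal t k) (v : V) :
    M.degreeIn Finset.univ v = k * t := by
  cases h with
  | complete hs hst hU hcard =>
    rw [hU.degreeIn_eq (Finset.mem_univ v), Finset.card_univ, hcard, Nat.add_sub_cancel,
      ← mul_assoc, Nat.mul_div_cancel' hst, mul_comm]
  | @cycle n G hn hodd f h =>
    obtain ⟨m, rfl⟩ := Nat.exists_eq_add_of_le' hn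
    rw [h.degreeIn_eq, ← f.degree_eq v, ← SimpleGraph.cycleGraph_degree_three_le (v := f v)]
  | regular h => rw [h, one_mul]

lemma IsUniformOn.not_isColorable (hU : M.IsUniformOn s Finset.univ) (hs : 0 < s) (hst : s ∣ t)
    (hcard : t / s * p < Fintype.card V) : ¬ M.IsColorable t p := by
  rintro ⟨c, hc⟩
  have hclass (a : Fin p) : (colorClass c a).card ≤ t / s :=
    (hU.mono (Finset.subset_univ _)).card_le_div (hc a) hs hst
  refine hcard.not_ge ?_
  calc Fintype.card V ≤ t / s * (Finset.univ : Finset (Fin p)).card :=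
        Finset.card_le_mul_card_image_of_maps_to (fun x _ => Finset.mem_univ (c x)) _
          fun a _ => by convert hclass a; ext; simp
    _ = t / s * p := by rw [Finset.card_univ, Fintype.card_fin]

theorem IsExtremal.not_isColorable (h : M.IsExtremal t k) [Nonempty V] : ¬ M.IsColorable t k := by
  cases h with
  | complete hs hst hU hcard => exact hU.not_isColorable hs hst (by lia)
  | @cycle n G hn hodd f h =>
    intro hc
    have hle := ((h.colorable_of_isColorable hc).of_hom f.symm.toHom).chromaticNumber_le
    rw [SimpleGraph.chromaticNumber_cycleGraph_of_odd n (by lia) hodd] at hle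
    exact absurd hle (by decide)
  | regular h =>
    rintro ⟨c, hc⟩
    obtain ⟨v, -, hv⟩ := hc 0 Finset.univ (fun x _ => by simp [Subsingleton.elim (c x) 0])
      Finset.univ_nonempty
    exact hv.ne (h v)

lemma IsConnectedOn.isExtremal_zero (hconn : M.IsConnectedOn Finset.univ)
    (ht : 0 < t) (hdeg : ∀ v, M.degreeIn Finset.univ v = 0) : M.IsExtremal t 0 := by
  obtain ⟨v, -⟩ := hconn.1
  have hv : {v} = (Finset.univ : Finset V) := by
    by_contra hne
    obtain ⟨x, -, y, hy, -, hxy⟩ := hconn.2 {v} (Finset.subset_univ _) (by simp) hne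
    exact hxy (Finset.sum_eq_zero_iff.1 (hdeg x) y hy)
  have hcard : Fintype.card V = 1 := by rw [← Finset.card_univ, ← hv, Finset.card_singleton]
  refine .complete ht dvd_rfl (fun x _ y _ hxy => absurd ?_ hxy) (by simpa using hcard)
  rw [Finset.mem_singleton.1 (hv.ge (Finset.mem_univ x)),
    Finset.mem_singleton.1 (hv.ge (Finset.mem_univ y))]

lemma IsUniformOn.isExtremal (hU : M.IsUniformOn s Finset.univ) (hs : 0 < s) (hst : s ∣ t)
    [Nonempty V] (hdeg : ∀ v, M.degreeIn Finset.univ v = k * t) : M.IsExtremal t k := by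
  obtain ⟨q, rfl⟩ := hst
  refine .complete hs ⟨q, rfl⟩ hU ?_
  have hcard := hdeg (Classical.arbitrary V)
  rw [hU.degreeIn_eq (Finset.mem_univ _), Finset.card_univ, mul_left_comm] at hcard
  rw [Nat.mul_div_cancel_left q hs, mul_comm q, ← Nat.eq_of_mul_eq_mul_left hs hcard,
    Nat.sub_add_cancel Fintype.card_pos]

lemma IsInflation.isExtremal {G : SimpleGraph V} (h : M.IsInflation t G) (ht : 0 < t)
    (hconn : G.Connected) (hreg : G.IsRegularOfDegree 2) (hc : ¬ M.IsColorable t 2) :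
    M.IsExtremal t 2 := by
  obtain ⟨n, hn, ⟨f⟩⟩ := exists_iso_cycleGraph hconn hreg
  refine .cycle hn (Nat.not_even_iff_odd.1 fun heven => hc ?_) f h
  have hcol := (SimpleGraph.cycleGraph.bicoloring_of_even n heven).colorable
  exact h.isColorable ht (hcol.of_hom f.toHom)

theorem isExtremal_of_not_isColorable (ht : 0 < t) (hconn : M.IsConnectedOn Finset.univ)
    (hle : ∀ x, M.degreeIn Finset.univ x ≤ k * t) (h : ¬ M.IsColorable t k) :
    M.IsExtremal t k := by
  have hdeg := degreeIn_eq_of_not_isColorable hconn hle h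
  rcases k with _ | _ | k
  · exact hconn.isExtremal_zero ht (by simpa using hdeg)
  · exact .regular (by simpa using hdeg)
  have hM := isCritical_mergedThreshold ht k.succ_pos hconn hle h
  have : Nonempty V := hconn.1.to_type
  by_cases hU : ∃ s, 0 < s ∧ M.IsUniformOn s Finset.univ
  · obtain ⟨s, hs, hU⟩ := hU
    exact hU.isExtremal hs (hM.dvd_of_isUniformOn hU true) hdeg
  have hpair : ∀ c v, M.IsHole (mergedThreshold t (k + 1)) c v → (M.component c v).card = 2 :=
    fun c v hc => hM.uniform_or_card_component_eq_two hc |>.resolve_left hU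
  have hupper v : M.support.degree v ≤ 2 := by
    rw [degree_support]
    exact hM.card_neighbors_le_two hpair v
  have hlower v : k + 2 ≤ M.support.degree v := by
    obtain ⟨c, hc⟩ := exists_isHole (T := fun _ : Fin (k + 2) => t) hconn (by simpa using hle) v
    rw [degree_support]
    exact le_card_neighbors ht h hc
  obtain rfl : k = 0 := by
    obtain ⟨v, -⟩ := hconn.1
    have hbounds := (hlower v).trans (hupper v)
    lia
  have hinflation : M.IsInflation t M.support := isInflation_support fun x y hxy => by
    obtain ⟨b, hb⟩ := hM.mult_eq_of_card_component hpair hxy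
    cases b <;> simpa [mergedThreshold] using hb
  exact hinflation.isExtremal ht hconn.connected_support
    (fun v => (hupper v).antisymm (hlower v)) h

end Extremal

section Isomorphism

variable {α β α' β' : Type*} {G : Graph α β} {H : Graph α' β'}

/-- The number of edges joining `x` and `y`. -/
def edgeCount (G : Graph α β) (x y : α) : ℕ := {e | G.IsLink e x y}.ncard

lemma exists_ends (G : Graph α β) :
    ∃ ends : E(G) → Sym2 V(G), ∀ (e : E(G)) (x y : V(G)), G.IsLink e x y ↔ ends e = s(x, y) := by
  have hexists (e : E(G)) : ∃ z : Sym2 V(G), ∀ x y : V(G), G.IsLink e x y ↔ z = s(x, y) := by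
    obtain ⟨x, y, h⟩ := Graph.exists_isLink_of_mem_edgeSet e.2
    refine ⟨s(⟨x, h.left_mem⟩, ⟨y, h.right_mem⟩), fun x' y' => ?_⟩
    rw [h.isLink_iff_sym2_eq, Sym2.eq_iff, Sym2.eq_iff]
    simp only [Subtype.ext_iff]
  choose ends hends using hexists
  exact ⟨ends, hends⟩

lemma edgeCount_eq_card (x y : α) : edgeCount G x y = Nat.card {e : E(G) // G.IsLink e x y} := by
  rw [edgeCount, ← Nat.card_coe_set_eq]
  exact Nat.card_congr ((Equiv.subtypeSubtypeEquivSubtype Graph.IsLink.edge_mem).symm)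

lemma finite_setOf_isLink [Finite E(G)] (x y : α) : {e | G.IsLink e x y}.Finite :=
  (Set.toFinite E(G)).subset fun _ h => h.edge_mem

lemma isIsomorphic_iff [Finite E(G)] [Finite E(H)] : G.IsIsomorphic H ↔
    ∃ f : V(G) ≃ V(H), ∀ x y : V(G), edgeCount G x y = edgeCount H (f x) (f y) := by
  simp only [edgeCount_eq_card]
  constructor
  · rintro ⟨f, g, h⟩
    exact ⟨f, fun x y => Nat.card_congr (g.subtypeEquiv fun e => h e x y)⟩
  rintro ⟨f, hf⟩
  obtain ⟨ends, hends⟩ := exists_ends G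
  obtain ⟨ends', hends'⟩ := exists_ends H
  have hinj : Function.Injective (Sym2.map f) := Sym2.map.injective f.injective
  have hfiber (z : Sym2 V(H)) : Nonempty
      ({e : E(G) // Sym2.map f (ends e) = z} ≃ {e : E(H) // ends' e = z}) := by
    obtain ⟨z, rfl⟩ : ∃ z', Sym2.map f z' = z :=
      ⟨Sym2.map f.symm z, by rw [Sym2.map_map, Equiv.self_comp_symm, Sym2.map_id, id]⟩
    induction z with | _ x y
    rw [← Finite.card_eq]
    simp only [hinj.eq_iff]
    simpa only [hends, hends', Sym2.map_mk] using hf x y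
  let g : E(G) ≃ E(H) :=
    Equiv.ofFiberEquiv (f := fun e => Sym2.map f (ends e)) (g := ends') fun z => (hfiber z).some
  have hg (e : E(G)) : ends' (g e) = Sym2.map f (ends e) := Equiv.ofFiberEquiv_map _ e
  refine ⟨f, g, fun e x y => ?_⟩
  rw [hends, hends', hg, ← Sym2.map_mk, hinj.eq_iff]

lemma edgeCount_inflation {V : Type*} (s : ℕ) (S : SimpleGraph V) (x y : V) :
    edgeCount (Graph.inflation s (Graph.ofSimpleGraph S)) x y = if S.Adj x y then s else 0 := by
  have hlink (e : Sym2 V × Fin s) :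
      (Graph.inflation s (Graph.ofSimpleGraph S)).IsLink e x y ↔ s(x, y) = e.1 ∧ S.Adj x y := by
    change e.1 = s(x, y) ∧ e.1 ∈ S.edgeSet ↔ _
    rw [eq_comm]
    exact and_congr_right fun h => by rw [← h, SimpleGraph.mem_edgeSet]
  simp only [edgeCount, hlink]
  split_ifs with h
  · have hrange : {e : Sym2 V × Fin s | s(x, y) = e.1 ∧ S.Adj x y} =
        Set.range (Prod.mk s(x, y)) := by
      ext ⟨z, i⟩
      simp [h]
    rw [hrange, ← Nat.card_coe_set_eq, Nat.card_range_of_injective (Prod.mk_right_injective _),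
      Nat.card_fin]
  · simp [h]

end Isomorphism

section OfGraph

variable {α β : Type*} {G : Graph α β} [G.Loopless] [Finite E(G)] {s t n k : ℕ}

variable (G) in
/-- The edge multiplicities of a loopless multigraph. -/
def ofGraph : EdgeMult V(G) where
  mult x y := edgeCount G x y
  symm x y := by simp only [edgeCount, Graph.isLink_comm]
  loopless x := by
    have hempty : {e | G.IsLink e x x} = ∅ :=
      Set.eq_empty_of_forall_notMem fun e h => h.ne rfl
    rw [edgeCount, hempty, Set.ncard_empty]

lemma isIsomorphic_inflation_iff {V : Type*} [Finite V] {S : SimpleGraph V} :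
    G.IsIsomorphic (Graph.inflation s (Graph.ofSimpleGraph S)) ↔
      ∃ f : V(G) ≃ V, (ofGraph G).IsInflation s (S.comap f) := by
  rw [isIsomorphic_iff]
  constructor
  · rintro ⟨f, hf⟩
    exact ⟨f.trans (Equiv.Set.univ V), fun x y => (hf x y).trans (edgeCount_inflation s S _ _)⟩
  · rintro ⟨f, hf⟩
    exact ⟨f.trans (Equiv.Set.univ V).symm, fun x y =>
      (hf x y).trans (edgeCount_inflation s S _ _).symm⟩

lemma mult_ofGraph_ne_zero {x y : V(G)} : (ofGraph G).mult x y ≠ 0 ↔ G.Adj x y :=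
  Nat.pos_iff_ne_zero.symm.trans (Set.ncard_pos (finite_setOf_isLink _ _))

omit [G.Loopless] in
lemma degree_le_degree_induce {H : Graph α β} (hHG : H ≤ G) (v : α) :
    H.degree v ≤ (G.induce V(H)).degree v := by
  refine Set.ncard_le_ncard ?_ ((Set.toFinite E(G)).subset ?_)
  · rintro e ⟨x, he⟩
    exact ⟨x, he.mono hHG, he.left_mem, he.right_mem⟩
  · rintro e ⟨x, he⟩
    exact he.1.edge_mem

lemma degree_induce {B : Finset V(G)} {v : V(G)} (hv : v ∈ B) :
    (G.induce (Subtype.val '' (B : Set V(G)))).degree v = (ofGraph G).degreeIn B v := by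
  have hincidence : (G.induce (Subtype.val '' (B : Set V(G)))).incidenceSet v =
      ⋃ x ∈ B, {e | G.IsLink e v x} := by
    ext e
    simp only [Graph.mem_incidenceSet, Graph.Inc, Graph.induce_isLink, Set.mem_iUnion]
    constructor
    · rintro ⟨_, h, -, y, hy, rfl⟩
      exact ⟨y, hy, h⟩
    · rintro ⟨y, hy, h⟩
      exact ⟨y, h, ⟨v, hv, rfl⟩, ⟨y, hy, rfl⟩⟩
  have hdisjoint : (B : Set V(G)).PairwiseDisjoint fun x : V(G) => {e | G.IsLink e v x} :=
    fun x _ y _ hxy => Set.disjoint_left.2 fun e hx hy =>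
      hxy (Subtype.ext (Graph.IsLink.right_unique hx hy))
  rw [Graph.degree, hincidence, ← Finset.set_biUnion_coe, B.finite_toSet.ncard_biUnion
    (fun x _ => finite_setOf_isLink _ _) hdisjoint, finsum_mem_coe_finset]
  rfl

lemma isStrictlyDegenerate_induce_iff {A : Finset V(G)} :
    (G.induce (Subtype.val '' (A : Set V(G)))).IsStrictlyDegenerate t ↔
      (ofGraph G).IsDegenerateOn t A := by
  constructor
  · intro h B hB hn
    obtain ⟨_, ⟨v, hv, rfl⟩, hlt⟩ := h (G.induce (Subtype.val '' (B : Set V(G))))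
      ⟨Set.image_mono hB, fun e x y he =>
        ⟨he.1, Set.image_mono hB he.2.1, Set.image_mono hB he.2.2⟩⟩ (hn.to_set.image _)
    exact ⟨v, hv, degree_induce hv ▸ hlt⟩
  · intro h H hH hn
    obtain ⟨B, hBA, hB⟩ := Set.subset_image_iff.1 hH.vertexSet_mono
    lift B to Finset V(G) using A.finite_toSet.subset hBA
    obtain ⟨v, hv, hlt⟩ := h B (Finset.coe_subset.1 hBA) (by simpa [← hB] using hn)
    rw [← degree_induce hv, hB] at hlt
    have hHG : H ≤ G := ⟨fun x hx => by obtain ⟨y, -, rfl⟩ := hB.ge hx; exact y.2,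
      fun e x y he => (hH.isLink_mono he).1⟩
    exact ⟨v, hB.le ⟨v, hv, rfl⟩, (degree_le_degree_induce hHG v).trans_lt hlt⟩

lemma isSDColoring_iff [Fintype V(G)] {c : V(G) → Fin k} :
    G.IsSDColoring t c ↔ (ofGraph G).IsColoringOn (fun _ => t) Finset.univ c := by
  refine forall_congr' fun a => ?_
  have hclass : c ⁻¹' {a} = (colorClass c a : Set V(G)) := by
    ext
    simp
  rw [hclass, isStrictlyDegenerate_induce_iff]
  rfl

lemma pointPartitionNumber_le_iff [Fintype V(G)] (ht : 0 < t) :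
    G.pointPartitionNumber t ≤ k ↔ (ofGraph G).IsColorable t k := by
  have hsInf : G.pointPartitionNumber t = sInf {k | (ofGraph G).IsColorable t k} := by
    simp only [Graph.pointPartitionNumber, isSDColoring_iff, IsColorable]
  have hmin : (ofGraph G).IsColorable t (sInf {k | (ofGraph G).IsColorable t k}) :=
    Nat.sInf_mem (s := {k | (ofGraph G).IsColorable t k}) ⟨_, isColorable_card (ofGraph G) ht⟩
  rw [hsInf]
  exact ⟨hmin.mono, fun h => Nat.sInf_le h⟩

lemma isConnectedOn_ofGraph [Fintype V(G)] (hG : G.Connected) :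
    (ofGraph G).IsConnectedOn Finset.univ := by
  obtain ⟨⟨v, hv⟩, hwalk⟩ := hG
  refine isConnectedOn_of_forall_subset ⟨⟨v, hv⟩, Finset.mem_univ _⟩
    fun B _ ⟨x, hx⟩ hclosed y _ => ?_
  have hreach (z : α) (hz : Relation.ReflTransGen G.Adj x z) : ∃ h : z ∈ V(G), ⟨z, h⟩ ∈ B := by
    induction hz with
    | refl => exact ⟨x.2, hx⟩
    | tail _ hadj ih =>
      obtain ⟨_, hzB⟩ := ih
      exact ⟨hadj.right_mem, hclosed _ hzB ⟨_, hadj.right_mem⟩ (Finset.mem_univ _)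
        (mult_ofGraph_ne_zero.2 hadj)⟩
  exact (hreach y (hwalk x x.2 y y.2)).2

lemma degree_eq_degreeIn [Fintype V(G)] (v : V(G)) :
    G.degree v = (ofGraph G).degreeIn Finset.univ v := by
  rw [← degree_induce (Finset.mem_univ v)]
  simp

lemma degreeIn_le_maxDegree [Fintype V(G)] (v : V(G)) :
    (ofGraph G).degreeIn Finset.univ v ≤ G.maxDegree := by
  rw [← degree_eq_degreeIn]
  exact le_csSup ((Set.toFinite V(G)).image _).bddAbove ⟨v, v.2, rfl⟩

lemma isRegularOfDegree_iff [Fintype V(G)] {d : ℕ} :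
    G.IsRegularOfDegree d ↔ ∀ v, (ofGraph G).degreeIn Finset.univ v = d := by
  simp [Graph.IsRegularOfDegree, ← degree_eq_degreeIn]

omit [G.Loopless] [Finite E(G)] in
lemma maxDegree_eq {d : ℕ} (hV : V(G).Nonempty) (h : G.IsRegularOfDegree d) : G.maxDegree = d := by
  rw [Graph.maxDegree, Set.image_congr h, hV.image_const, csSup_singleton]

lemma isIsomorphic_inflation_complete_iff [Fintype V(G)] :
    G.IsIsomorphic (Graph.inflation s (Graph.complete n)) ↔
      (ofGraph G).IsUniformOn s Finset.univ ∧ Fintype.card V(G) = n := by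
  rw [Graph.complete, isIsomorphic_inflation_iff]
  constructor
  · rintro ⟨f, hf⟩
    refine ⟨fun x _ y _ hxy => ?_, by simpa using Fintype.card_congr f⟩
    simpa [hxy] using hf x y
  · rintro ⟨hU, hn⟩
    refine ⟨Fintype.equivFinOfCardEq hn, fun x y => ?_⟩
    by_cases hxy : x = y
    · simp [hxy, (ofGraph G).loopless]
    · simpa [hxy] using hU x (Finset.mem_univ x) y (Finset.mem_univ y) hxy

lemma isIsomorphic_inflation_cycle_iff :
    G.IsIsomorphic (Graph.inflation s (Graph.cycle n)) ↔ ∃ (S : SimpleGraph V(G))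
      (_ : S ≃g SimpleGraph.cycleGraph n), (ofGraph G).IsInflation s S := by
  rw [Graph.cycle, isIsomorphic_inflation_iff]
  constructor
  · rintro ⟨f, hf⟩
    exact ⟨_, SimpleGraph.Iso.comap f _, hf⟩
  · rintro ⟨S, f, hf⟩
    exact ⟨f.toEquiv, fun x y => by simpa [f.map_adj_iff] using hf x y⟩

lemma isExtremal_of_isIsomorphic_complete [Fintype V(G)] (hs : 0 < s) (hst : s ∣ t)
    (h : G.IsIsomorphic (Graph.inflation s (Graph.complete (t / s * k + 1)))) :
    (ofGraph G).IsExtremal t k :=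
  have ⟨hU, hcard⟩ := isIsomorphic_inflation_complete_iff.1 h
  .complete hs hst hU hcard

lemma isExtremal_of_isIsomorphic_cycle [Fintype V(G)] (hn : 3 ≤ n) (hodd : Odd n)
    (h : G.IsIsomorphic (Graph.inflation t (Graph.cycle n))) : (ofGraph G).IsExtremal t 2 :=
  have ⟨_, f, hS⟩ := isIsomorphic_inflation_cycle_iff.1 h
  .cycle hn hodd f hS

lemma isExtremal_of_isRegularOfDegree [Fintype V(G)] (h : G.IsRegularOfDegree t) :
    (ofGraph G).IsExtremal t 1 :=
  .regular (isRegularOfDegree_iff.1 h)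

lemma exists_isExtremal_iff [Fintype V(G)] (ht : 0 < t) {m : ℕ} :
    (∃ k, (ofGraph G).IsExtremal t k ∧ m = k + 1) ↔
      (∃ s p : ℕ, 1 ≤ s ∧ s ≤ t ∧ s ∣ t ∧
        G.IsIsomorphic (Graph.inflation s (Graph.complete (t / s * p + 1))) ∧ m = p + 1) ∨
      (∃ n : ℕ, 3 ≤ n ∧ Odd n ∧ G.IsIsomorphic (Graph.inflation t (Graph.cycle n)) ∧ m = 3) ∨
      (G.IsRegularOfDegree t ∧ m = 2) := by
  constructor
  · rintro ⟨k, ⟨hs, hst, hU, hcard⟩ | ⟨hn, hodd, f, hS⟩ | hreg, hm⟩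
    · exact .inl ⟨_, _, hs, Nat.le_of_dvd ht hst, hst,
        isIsomorphic_inflation_complete_iff.2 ⟨hU, hcard⟩, hm⟩
    · exact .inr (.inl ⟨_, hn, hodd, isIsomorphic_inflation_cycle_iff.2 ⟨_, f, hS⟩, hm⟩)
    · exact .inr (.inr ⟨isRegularOfDegree_iff.2 hreg, hm⟩)
  · rintro (⟨s, p, hs, -, hst, h, hm⟩ | ⟨n, hn, hodd, h, hm⟩ | ⟨hreg, hm⟩)
    · exact ⟨p, isExtremal_of_isIsomorphic_complete hs hst h, hm⟩
    · exact ⟨2, isExtremal_of_isIsomorphic_cycle hn hodd h, hm⟩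
    · exact ⟨1, isExtremal_of_isRegularOfDegree hreg, hm⟩

omit [G.Loopless] [Finite E(G)] in
lemma maxDegree_le_ceil_mul (ht : 0 < t) : G.maxDegree ≤ ⌈(G.maxDegree : ℚ) / (t : ℚ)⌉₊ * t := by
  have hceil := Nat.le_ceil ((G.maxDegree : ℚ) / (t : ℚ))
  rw [div_le_iff₀ (by exact_mod_cast ht)] at hceil
  exact_mod_cast hceil

lemma pointPartitionNumber_le [Finite V(G)] (ht : 0 < t) :
    G.pointPartitionNumber t ≤ ⌈(G.maxDegree : ℚ) / (t : ℚ)⌉₊ + 1 := by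
  have := Fintype.ofFinite V(G)
  refine (pointPartitionNumber_le_iff ht).2 (IsDegenerateOn.isColorable ?_)
  rintro B - ⟨v, hv⟩
  refine ⟨v, hv, ?_⟩
  calc (ofGraph G).degreeIn B v
      ≤ (ofGraph G).degreeIn Finset.univ v := degreeIn_mono (Finset.subset_univ B) v
    _ ≤ G.maxDegree := degreeIn_le_maxDegree v
    _ ≤ ⌈(G.maxDegree : ℚ) / (t : ℚ)⌉₊ * t := maxDegree_le_ceil_mul ht
    _ < (⌈(G.maxDegree : ℚ) / (t : ℚ)⌉₊ + 1) * t :=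
      Nat.mul_lt_mul_of_pos_right (Nat.lt_succ_self _) ht

lemma IsExtremal.ceil_eq [Fintype V(G)] (ht : 0 < t) (hV : V(G).Nonempty)
    (h : (ofGraph G).IsExtremal t k) : ⌈(G.maxDegree : ℚ) / (t : ℚ)⌉₊ = k := by
  rw [maxDegree_eq hV (isRegularOfDegree_iff.2 h.degreeIn_eq), Nat.cast_mul,
    mul_div_cancel_right₀ _ (by exact_mod_cast ht.ne'), Nat.ceil_natCast]

lemma IsExtremal.pointPartitionNumber_eq [Fintype V(G)] (ht : 0 < t) (hV : V(G).Nonempty)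
    (h : (ofGraph G).IsExtremal t k) : G.pointPartitionNumber t = k + 1 := by
  have : Nonempty V(G) := hV.to_subtype
  refine le_antisymm ?_ (Nat.lt_of_not_le fun hle =>
    h.not_isColorable ((pointPartitionNumber_le_iff ht).1 hle))
  rw [← h.ceil_eq ht hV]
  exact pointPartitionNumber_le ht

lemma pointPartitionNumber_eq_iff [Fintype V(G)] (ht : 0 < t) (hG : G.Connected) :
    G.pointPartitionNumber t = ⌈(G.maxDegree : ℚ) / (t : ℚ)⌉₊ + 1 ↔
      ∃ k, (ofGraph G).IsExtremal t k ∧ G.pointPartitionNumber t = k + 1 := by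
  constructor
  · intro heq
    refine ⟨_, isExtremal_of_not_isColorable ht (isConnectedOn_ofGraph hG)
      (fun v => (degreeIn_le_maxDegree v).trans (maxDegree_le_ceil_mul ht)) ?_, heq⟩
    rw [← pointPartitionNumber_le_iff ht, heq]
    exact Nat.not_succ_le_self _
  · rintro ⟨k, hext, heq⟩
    rw [heq, hext.ceil_eq ht hG.1]

end OfGraph

end EdgeMult

end

theorem theorem3p6 {α β : Type*} (t : ℕ) (ht : 1 ≤ t) (G : Graph α β) [G.Loopless]
    (hV : V(G).Finite) (hE : E(G).Finite) (hG : G.Connected) :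
    G.pointPartitionNumber t ≤ ⌈(G.maxDegree : ℚ) / (t : ℚ)⌉₊ + 1 ∧
    (G.pointPartitionNumber t = ⌈(G.maxDegree : ℚ) / (t : ℚ)⌉₊ + 1 ↔
      (∃ s p : ℕ, 1 ≤ s ∧ s ≤ t ∧ s ∣ t ∧
        G.IsIsomorphic (Graph.inflation s (Graph.complete (t / s * p + 1))) ∧
        G.pointPartitionNumber t = p + 1) ∨
      (∃ n : ℕ, 3 ≤ n ∧ Odd n ∧ G.IsIsomorphic (Graph.inflation t (Graph.cycle n)) ∧
        G.pointPartitionNumber t = 3) ∨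
      (G.IsRegularOfDegree t ∧ G.pointPartitionNumber t = 2)) ∧
    -- the values of the point partition number in the three cases are automatic
    (∀ s p : ℕ, 1 ≤ s → s ≤ t → s ∣ t →
      G.IsIsomorphic (Graph.inflation s (Graph.complete (t / s * p + 1))) →
      G.pointPartitionNumber t = p + 1) ∧
    (∀ n : ℕ, 3 ≤ n → Odd n → G.IsIsomorphic (Graph.inflation t (Graph.cycle n)) →
      G.pointPartitionNumber t = 3) ∧
    (G.IsRegularOfDegree t → G.pointPartitionNumber t = 2) := by
  have := hV.fintype
  have : Finite E(G) := hE
  have hvalue {k : ℕ} (h : (EdgeMult.ofGraph G).IsExtremal t k) :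
      G.pointPartitionNumber t = k + 1 := h.pointPartitionNumber_eq ht hG.1
  exact ⟨EdgeMult.pointPartitionNumber_le ht,
    (EdgeMult.pointPartitionNumber_eq_iff ht hG).trans (EdgeMult.exists_isExtremal_iff ht),
    fun _ _ hs _ hst h => hvalue (EdgeMult.isExtremal_of_isIsomorphic_complete hs hst h),
    fun _ hn hodd h => hvalue (EdgeMult.isExtremal_of_isIsomorphic_cycle hn hodd h),
    fun h => hvalue (EdgeMult.isExtremal_of_isRegularOfDegree h)⟩
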